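/- Let $\xi=\{\xi_1,\dots,\xi_d\}$ be a basis of $\mathbb{R}^d$ spanning the lattice $\Lambda$, let $C_\xi=\bigoplus_{i=1}^d[0,\xi_i]$ be its unit cell, and let $n\ge 1$. Put $C^n_{0,0}=\{\sum_i m_i\xi_i : m_i\in\{0,\dots,n-1\}\}$ and let $(B_l,W_l)$, $l=0,\dots,2^{n^d}-1$, be the partitions of $C^n_{0,0}$ into a foreground set $B_l$ and a background set $W_l$, with $B_0=\emptyset$. A local estimator for the Euler characteristic $V_0$ is an estimator of the form $$\hat V_0^{a\Lambda_c}(X)=\sum_{l=1}^{2^{n^d}-1}w_l(a)\,\#\{z\in\Lambda : a(z+c)+aB_l\subseteq X,\ a(z+c)+aW_l\subseteq\mathbb{R}^d\setminus X\},\qquad a>0,\ c\in C_\xi,$$ where the weights $w_l(a)\in\mathbb{R}$ are arbitrary functions of $a>0$ that are motion and reflection invariant: $w_l(a)=w_k(a)$ whenever $R(B_l+z)=B_k+z'$ for some $z,z'\in\mathbb{R}^d$ and some orthogonal map $R$ with $R\Lambda=\Lambda$. Let $E\hat V_0(X)$ denote the mean of $\hat V_0^{a\Lambda_c}(X)$ when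 $c$ is uniformly distributed in $C_\xi$. Let $\mathcal P^d$ be the class of compact convex polytopes in $\mathbb{R}^d$ with non-empty interior, and let $V_0(X)$ be the coefficient of $r^d\kappa_d$ in the Steiner polynomial of $X$, where $\kappa_d$ is the volume of the unit ball. (i) If $d>1$, then every local estimator $\hat V_0$ for $V_0$ is integrable on $\mathcal P^d$ and asymptotically biased on $\mathcal P^d$: there is a $P\in\mathcal P^d$ for which $\lim_{a\to0^+}E\hat V_0(P)=V_0(P)$ fails (the limit does not exist or has another value). It is also not multigrid convergent on $\mathcal P^d$: there is a $P\in\mathcal P^d$ for which $\lim_{a\to0^+}\hat V_0^{a\Lambda_0}(P)=V_0(P)$ fails. (ii) Let $d=2$ and let $D_\Lambda\subseteq S^1$ be the set of all $z/|z|$ with $z=m_1\xi_1+m_2\xi_2\ne0$, $m_i\in\{-n,\dots,n-1\}$. For $s_1,s_2>0$ let $$P(\varphi,\psi,s_1,s_2)=[0,s_1v_1]\oplus[0,s_2v_2],\quad v_1=(\cos\varphi,\sin\varphi),\quad v_2=(\cos(\varphi+\psi),\sin(\varphi+\psi)).$$ Let $U\subseteq\mathbb{R}\times(0,\pi)$ be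 open and non-empty and such that for all $(\varphi,\psi)\in U$ the vectors $v_1$ and $v_2$ lie in the same connected component of $S^1\setminus D_\Lambda$. Then for every local estimator $\hat V_0$ for $V_0$ there are $(\varphi,\psi)\in U$ and $s_1,s_2>0$ such that $\lim_{a\to0^+}E\hat V_0(P(\varphi,\psi,s_1,s_2))=V_0(P(\varphi,\psi,s_1,s_2))$ fails. (iii) Let $d=2$, let $K$ be a connected component of $S^1\setminus D_\Lambda$ and let $\hat V_0$ be a local estimator for $V_0$. Suppose that for all $\varphi$ and all $\psi\in(0,\pi)$ with $v_1,v_2\in K$ the limit $L(\varphi,\psi)=\lim_{a\to0^+}E\hat V_0(P(\varphi,\psi,s_1,s_2))$ exists for all $s_1,s_2>0$ and does not depend on $s_1,s_2$. Then there are $\alpha_1,\alpha_2,\alpha_3\in\mathbb{R}$ such that for all these $(\varphi,\psi)$ $$L(\varphi,\psi)=\frac{\alpha_1\cos\varphi\cos(\varphi+\psi)+\alpha_2\sin\varphi\sin(\varphi+\psi)+\alpha_3\big(\cos\varphi\sin(\varphi+\psi)+\sin\varphi\cos(\varphi+\psi)\big)}{\sin\psi}.$$ On every non-empty open subset of $\mathbb{R}\times(0,\pi)$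 the three functions multiplied by $\alpha_1,\alpha_2,\alpha_3$ (each including the factor $1/\sin\psi$) and the constant function $1$ are linearly independent. -/

import Mathlib

open Set Filter Topology MeasureTheory
open scoped Pointwise

noncomputable section

namespace LocalEstimator

/-- `ℝ^d` with its Euclidean structure. -/
abbrev E (d : ℕ) : Type := EuclideanSpace ℝ (Fin d)

/-! ### Intrinsic volumes and polytopes -/

/-- The volume `κ_k` of the unit ball of `ℝ^k`. -/
def ballVolume (k : ℕ) : ℝ := (volume (Metric.closedBall (0 : E k) 1)).toReal

/-- `V 0, …, V d` are the coefficients of `X` in the Steiner formula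
`vol (X ⊕ B(r)) = ∑ q, r ^ (d - q) κ_{d - q} V_q` for all `r ≥ 0`. -/
def IsSteiner {d : ℕ} (X : Set (E d)) (V : Fin (d + 1) → ℝ) : Prop :=
  ∀ r : ℝ, 0 ≤ r →
    (volume (X + Metric.closedBall (0 : E d) r)).toReal
      = ∑ q : Fin (d + 1), r ^ (d - (q : ℕ)) * ballVolume (d - (q : ℕ)) * V q

open scoped Classical in
/-- The intrinsic volume `V_q(X)`: the coefficient with index `q` in the Steiner formula. These
coefficients are unique, and they exist for every nonempty compact convex set; the value is `0` for
sets that have no Steiner formula. -/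
def intrinsicVolume {d : ℕ} (q : Fin (d + 1)) (X : Set (E d)) : ℝ :=
  if h : ∃ V : Fin (d + 1) → ℝ, IsSteiner X V then h.choose q else 0

/-- The Euler characteristic, that is, the intrinsic volume `V_0`. -/
def eulerChar {d : ℕ} (X : Set (E d)) : ℝ := intrinsicVolume 0 X

/-- The class of compact convex polytopes in `ℝ^d` with nonempty interior. -/
def polytopes (d : ℕ) : Set (Set (E d)) :=
  {P | (∃ s : Set (E d), s.Finite ∧ P = convexHull ℝ s) ∧ (interior P).Nonempty}

/-! ### Lattices and digital images -/

/-- The lattice `Λ` spanned by the basis `ξ`. -/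
def lattice {d : ℕ} (ξ : Module.Basis (Fin d) ℝ (E d)) : Submodule ℤ (E d) :=
  Submodule.span ℤ (Set.range ξ)

/-- The scaled and translated lattice `aΛ_c = a(Λ + c)`. -/
def scaledLattice {d : ℕ} (ξ : Module.Basis (Fin d) ℝ (E d)) (a : ℝ) (c : E d) : Set (E d) :=
  {x | ∃ z ∈ lattice ξ, x = a • (z + c)}

/-- A digital algorithm: `A a c` is the function `V̂^{aΛ_c}`, to be applied to subsets of `aΛ_c`. -/
abbrev Algorithm (d : ℕ) : Type := ℝ → E d → Set (E d) → ℝ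

/-- The digital estimator `V̂^{aΛ_c}(X) = V̂^{aΛ_c}(X ∩ aΛ_c)`. -/
def estimate {d : ℕ} (ξ : Module.Basis (Fin d) ℝ (E d)) (A : Algorithm d) (X : Set (E d))
    (a : ℝ) (c : E d) : ℝ :=
  A a c (X ∩ scaledLattice ξ a c)

/-- The mean `E V̂^{aΛ_c}(X)`, where `c` is uniformly distributed in the closed unit cell
`C_ξ = ⨁ [0, ξ_i]`. -/
def meanEstimate {d : ℕ} (ξ : Module.Basis (Fin d) ℝ (E d)) (A : Algorithm d) (X : Set (E d))
    (a : ℝ) : ℝ :=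
  ⨍ c in parallelepiped ξ, estimate ξ A X a c

/-- The algorithm is integrable on the class `S`. -/
def IsIntegrableOn {d : ℕ} (ξ : Module.Basis (Fin d) ℝ (E d)) (A : Algorithm d)
    (S : Set (Set (E d))) : Prop :=
  ∀ X ∈ S, ∀ a : ℝ, 0 < a → IntegrableOn (fun c => estimate ξ A X a c) (parallelepiped ξ) volume

/-- The mean of the estimator at `X` tends to `V X` as `a → 0+`. -/
def IsAsymptoticallyUnbiasedAt {d : ℕ} (ξ : Module.Basis (Fin d) ℝ (E d)) (A : Algorithm d)
    (V : Set (E d) → ℝ) (X : Set (E d)) : Prop :=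
  Tendsto (fun a => meanEstimate ξ A X a) (𝓝[>] 0) (𝓝 (V X))

/-- Asymptotic unbiasedness of an (integrable) algorithm for `V` on the class `S`. -/
def IsAsymptoticallyUnbiasedOn {d : ℕ} (ξ : Module.Basis (Fin d) ℝ (E d)) (A : Algorithm d)
    (V : Set (E d) → ℝ) (S : Set (Set (E d))) : Prop :=
  ∀ X ∈ S, IsAsymptoticallyUnbiasedAt ξ A V X

/-- Multigrid convergence of an algorithm for `V` on the class `S` (untranslated lattice). -/
def IsMultigridConvergentOn {d : ℕ} (ξ : Module.Basis (Fin d) ℝ (E d)) (A : Algorithm d)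
    (V : Set (E d) → ℝ) (S : Set (Set (E d))) : Prop :=
  ∀ X ∈ S, Tendsto (fun a => estimate ξ A X a 0) (𝓝[>] 0) (𝓝 (V X))

/-! ### Local estimators based on `n × ⋯ × n` configurations -/

/-- The lattice point `∑ i, m_i ξ_i` of the cell `C^n_{0,0}`, where `m_i ∈ {0, …, n - 1}`. -/
def cellPoint {d n : ℕ} (ξ : Module.Basis (Fin d) ℝ (E d)) (m : Fin d → Fin n) : E d :=
  ∑ i, ((m i : ℕ) : ℝ) • ξ i

/-- A configuration `(B, W)` with `B ∪ W = C^n_{0,0}`, `B ∩ W = ∅`, is encoded by the coordinates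
of the points of `B`; there are `2 ^ (n ^ d)` of them. -/
abbrev Config (d n : ℕ) : Type := Finset (Fin d → Fin n)

/-- The foreground pixels of a configuration. -/
def foreground {d n : ℕ} (ξ : Module.Basis (Fin d) ℝ (E d)) (l : Config d n) : Set (E d) :=
  {x | ∃ m ∈ l, x = cellPoint ξ m}

/-- The background pixels of a configuration. -/
def background {d n : ℕ} (ξ : Module.Basis (Fin d) ℝ (E d)) (l : Config d n) : Set (E d) :=
  {x | ∃ m ∉ l, x = cellPoint ξ m}

/-- The hit-or-miss transform `{y | y + B ⊆ S, y + W ⊆ Sᶜ}`. -/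
def hitOrMiss {d : ℕ} (S B W : Set (E d)) : Set (E d) :=
  {y | (∀ b ∈ B, y + b ∈ S) ∧ ∀ w ∈ W, y + w ∉ S}

/-- The number `N_l(S)` of occurrences of the configuration `l` in the image `S ⊆ aΛ_c`. -/
def configCount {d n : ℕ} (ξ : Module.Basis (Fin d) ℝ (E d)) (l : Config d n)
    (a : ℝ) (c : E d) (S : Set (E d)) : ℝ :=
  ∑' z : lattice ξ,
    (hitOrMiss S (a • foreground ξ l) (a • background ξ l)).indicator (fun _ => (1 : ℝ))
      (a • ((z : E d) + c))

/-- The algorithm `∑_l w_l(a) N_l`; the sum is over the configurations with at least one foreground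
pixel. -/
def localAlgorithm {d n : ℕ} (ξ : Module.Basis (Fin d) ℝ (E d)) (w : ℝ → Config d n → ℝ) :
    Algorithm d :=
  fun a c S => ∑ l : Config d n with l.Nonempty, w a l * configCount ξ l a c S

/-- The (translation invariant) weights `w_l(a)` are motion and reflection invariant:
`w_l(a) = w_{l'}(a)` whenever `R(B_l + z) = B_{l'} + z'` for some `z, z'` and some orthogonal
map `R` that preserves `Λ`. -/
def IsInvariant {d n : ℕ} (ξ : Module.Basis (Fin d) ℝ (E d)) (w : ℝ → Config d n → ℝ) : Prop :=
  ∀ a : ℝ, 0 < a → ∀ R : E d ≃ₗᵢ[ℝ] E d, R '' (lattice ξ : Set (E d)) = (lattice ξ : Set (E d)) →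
    ∀ (l l' : Config d n) (z z' : E d),
      R '' ((fun b => b + z) '' foreground ξ l) = (fun b => b + z') '' foreground ξ l' →
        w a l = w a l'

/-! ### The plane -/

/-- The unit vector `(cos φ, sin φ)`. -/
def dir (φ : ℝ) : E 2 := !₂[Real.cos φ, Real.sin φ]

/-- The set `D_Λ ⊆ S¹` of directions of the nonzero lattice points with coordinates in
`{-n, …, n - 1}`. -/
def latticeDirections (ξ : Module.Basis (Fin 2) ℝ (E 2)) (n : ℕ) : Set (E 2) :=
  {x | ∃ m : Fin 2 → ℤ, (∀ i, -(n : ℤ) ≤ m i ∧ m i < (n : ℤ)) ∧ m ≠ 0 ∧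
    x = ‖∑ i, (m i : ℝ) • ξ i‖⁻¹ • ∑ i, (m i : ℝ) • ξ i}

/-- The connected component of `v` in `S¹ ∖ D_Λ` (empty if `v ∉ S¹ ∖ D_Λ`). -/
def dirComponent (ξ : Module.Basis (Fin 2) ℝ (E 2)) (n : ℕ) (v : E 2) : Set (E 2) :=
  connectedComponentIn (Metric.sphere (0 : E 2) 1 \ latticeDirections ξ n) v

/-- The parallelogram `[0, s₁ v₁] ⊕ [0, s₂ v₂]`, where `v₁ = (cos φ, sin φ)` and
`v₂ = (cos (φ + ψ), sin (φ + ψ))`. -/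
def parallelogram (φ ψ s₁ s₂ : ℝ) : Set (E 2) :=
  segment ℝ 0 (s₁ • dir φ) + segment ℝ 0 (s₂ • dir (φ + ψ))

/-- `cos φ cos (φ + ψ) csc ψ` -/
def trig₁ (φ ψ : ℝ) : ℝ := Real.cos φ * Real.cos (φ + ψ) / Real.sin ψ

/-- `sin φ sin (φ + ψ) csc ψ` -/
def trig₂ (φ ψ : ℝ) : ℝ := Real.sin φ * Real.sin (φ + ψ) / Real.sin ψ

/-- `(cos φ sin (φ + ψ) + sin φ cos (φ + ψ)) csc ψ` -/
def trig₃ (φ ψ : ℝ) : ℝ :=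
  (Real.cos φ * Real.sin (φ + ψ) + Real.sin φ * Real.cos (φ + ψ)) / Real.sin ψ

end LocalEstimator

end

noncomputable section

namespace LocalEstimator

/-! Möbius inversion over sets of pixels (`exists_estimate_eq_sum_hitCount`) rewrites a local
estimator as a combination, with new weights `W a I`, of the numbers of lattice translates at which
all pixels of a nonempty set `I` fall into `X`. The background conditions disappear. Averaging such
a count over the shift `c` unfolds the lattice sum and gives the volume of `hitSet ξ I a X` divided
by that of the unit cell.

For a box of side lengths `s i` in a basis `b`, the hit set is again a box, with sides `s i / a -
width ξ b I i`. So the mean is, for small `a`, affine in each `s i`. A combination over `s ∈ {1,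
2}^d` with coefficients of sum `1` isolates its constant term, `|ξ.det b|` times the sum of `W a I *
∏ i, (-width ξ b I i)`. Boxes have Euler characteristic `1`, so an unbiased estimator makes this
term tend to `1` for every basis.

In dimension `d > 1` three bases of the same lattice are found whose width products satisfy `P₃ - P₂
= 2 P₁` for all `I` at once (`exists_bases_prod_width`). In the limit this reads `1 - 1 = 2`. For
multigrid convergence the same contradiction is reached along `a = 1 / (2 j + 1)`, with boxes placed
so that the lattice count equals the product of the side lengths exactly.

For parallelograms with directions in one component of `S¹ ∖ D_Λ`, the order of the pixels
transverse to a direction does not depend on the direction. Each width is therefore a determinant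
with a fixed difference vector `Z I`, and the constant term is a symmetric bilinear form in `v₁, v₂`
divided by `sin ψ`, which gives the three trigonometric functions. The constant `1` is the
antisymmetric form `det (v₁, v₂)` divided by `sin ψ`, hence independent of them. That `V_0 = 1` for
boxes is derived from the Steiner polynomial of a parallelepiped. -/

/-- Every function on finite sets is a sum over subsets. -/
theorem exists_sum_powerset {α : Type*} [DecidableEq α] (g : Finset α → ℝ) :
    ∃ W : Finset α → ℝ, ∀ l, g l = ∑ I ∈ l.powerset, W I := by
  let W : Finset α → ℝ :=
    fun l => Finset.strongInduction (fun s ih => g s - ∑ J ∈ s.ssubsets.attach,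
      ih J.1 (Finset.mem_ssubsets.1 J.2)) l
  have hW : ∀ l, W l = g l - ∑ J ∈ l.ssubsets, W J := by
    intro l
    change Finset.strongInduction _ l = _
    rw [Finset.strongInduction_eq]
    congr 1
    exact Finset.sum_attach l.ssubsets W
  refine ⟨W, fun l => ?_⟩
  have h : l.powerset = insert l l.ssubsets := by
    ext J
    simp only [Finset.mem_powerset, Finset.mem_insert, Finset.mem_ssubsets]
    exact subset_iff_ssubset_or_eq.trans or_comm
  rw [h, Finset.sum_insert (by simp), hW l]
  ring

/-! ### Hit counts, Möbius inversion and means over the unit cell -/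

variable {d n : ℕ}

/-- The points `y` such that `a (y + x) ∈ X` for all pixels `x` of `I`. -/
def hitSet (ξ : Module.Basis (Fin d) ℝ (E d)) (I : Config d n) (a : ℝ) (X : Set (E d)) :
    Set (E d) :=
  {y | ∀ m ∈ I, a • (y + cellPoint ξ m) ∈ X}

/-- The number of lattice translates of `c` in `hitSet`. -/
def hitCount (ξ : Module.Basis (Fin d) ℝ (E d)) (I : Config d n) (a : ℝ) (X : Set (E d))
    (c : E d) : ℝ :=
  ∑' z : lattice ξ, (hitSet ξ I a X).indicator (fun _ => (1 : ℝ)) ((z : E d) + c)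

theorem isBounded_hitSet (ξ : Module.Basis (Fin d) ℝ (E d)) {I : Config d n} (hI : I.Nonempty)
    {a : ℝ} (ha : 0 < a) {X : Set (E d)} (hX : Bornology.IsBounded X) :
    Bornology.IsBounded (hitSet ξ I a X) := by
  obtain ⟨m, hm⟩ := hI
  refine ((hX.smul₀ a⁻¹).add (Bornology.isBounded_singleton (x := -cellPoint ξ m))).subset ?_
  intro y hy
  refine ⟨a⁻¹ • (a • (y + cellPoint ξ m)), smul_mem_smul_set (hy m hm), -cellPoint ξ m, rfl, ?_⟩
  simp [smul_smul, ha.ne']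

theorem measurableSet_hitSet (ξ : Module.Basis (Fin d) ℝ (E d)) (I : Config d n)
    (a : ℝ) {X : Set (E d)} (hX : MeasurableSet X) : MeasurableSet (hitSet ξ I a X) := by
  have : hitSet ξ I a X = ⋂ m ∈ I, (fun y => a • (y + cellPoint ξ m)) ⁻¹' X := by
    ext y; simp [hitSet]
  rw [this]
  refine Finset.measurableSet_biInter _ fun m _ => ?_
  exact hX.preimage (by fun_prop)

theorem finite_lattice_translates (ξ : Module.Basis (Fin d) ℝ (E d)) {H C : Set (E d)}
    (hH : Bornology.IsBounded H) (hC : Bornology.IsBounded C) :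
    {z : lattice ξ | ∃ c ∈ C, (z : E d) + c ∈ H}.Finite := by
  have h := ZSpan.setFinite_inter ξ (hH.sub hC)
  have h2 := h.preimage (f := ((↑) : lattice ξ → E d)) Subtype.val_injective.injOn
  refine h2.subset ?_
  rintro z ⟨c, hc, hz⟩
  exact ⟨⟨_, hz, c, hc, by simp⟩, z.2⟩

theorem indicator_one_apply {α : Type*} (s : Set α) (x : α) [Decidable (x ∈ s)] :
    s.indicator (fun _ => (1 : ℝ)) x = if x ∈ s then 1 else 0 := by
  simp [Set.indicator_apply]

/-- Pixels of translates of the cell by lattice points always lie in `scaledLattice ξ a c`, so the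
restriction of `X` to the grid can be dropped. The hit and miss conditions then merge into one
equivalence per pixel. -/
theorem configCount_eq (ξ : Module.Basis (Fin d) ℝ (E d)) (l : Config d n) (a : ℝ) (c : E d)
    (X : Set (E d)) :
    configCount ξ l a c (X ∩ scaledLattice ξ a c) =
      ∑' z : lattice ξ,
        {y | ∀ m, m ∈ l ↔ a • (y + cellPoint ξ m) ∈ X}.indicator (fun _ => (1 : ℝ))
          ((z : E d) + c) := by
  classical
  refine tsum_congr fun z => ?_
  simp only [indicator_one_apply]
  refine if_congr ?_ rfl rfl
  have key : ∀ m : Fin d → Fin n, a • ((z : E d) + c) + a • cellPoint ξ m ∈ scaledLattice ξ a c := by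
    intro m
    refine ⟨z + cellPoint ξ m, ?_, ?_⟩
    · refine (lattice ξ).add_mem z.2 (Submodule.sum_mem _ fun i _ => ?_)
      have := (lattice ξ).smul_mem (m i : ℤ) (Submodule.subset_span (Set.mem_range_self i))
      rw [← Int.cast_smul_eq_zsmul ℝ] at this
      simpa using this
    · rw [← smul_add]; congr 1; abel
  have e : ∀ m : Fin d → Fin n, a • ((z : E d) + c) + a • cellPoint ξ m
      = a • ((z : E d) + c + cellPoint ξ m) := fun m => (smul_add _ _ _).symm
  constructor
  · rintro ⟨h1, h2⟩ m
    constructor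
    · intro hm
      rw [← e]
      exact (h1 _ (smul_mem_smul_set ⟨m, hm, rfl⟩)).1
    · intro hm
      by_contra hml
      refine h2 _ (smul_mem_smul_set ⟨m, hml, rfl⟩) ⟨?_, key m⟩
      rw [e]; exact hm
  · intro h
    constructor
    · rintro _ ⟨_, ⟨m, hm, rfl⟩, rfl⟩
      refine ⟨?_, key m⟩
      have := (h m).1 hm
      rwa [← e] at this
    · rintro _ ⟨_, ⟨m, hm, rfl⟩, rfl⟩ hx
      refine hm ((h m).2 ?_)
      rw [← e]; exact hx.1

/-- Möbius inversion trades conditions on foreground and background for conditions on hit pixels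
alone. It matters that the new weights depend neither on `X` nor on `c`. -/
theorem exists_estimate_eq_sum_hitCount (ξ : Module.Basis (Fin d) ℝ (E d))
    (w : ℝ → Config d n → ℝ) :
    ∃ W : ℝ → Config d n → ℝ, ∀ X : Set (E d), Bornology.IsBounded X → ∀ a : ℝ, 0 < a →
      ∀ c : E d, estimate ξ (localAlgorithm ξ w) X a c =
        ∑ I : Config d n with I.Nonempty, W a I * hitCount ξ I a X c := by
  classical
  -- The empty configuration, which the estimator omits, gets the value `0`. Hence `W a ∅ = 0`, and
  -- only nonempty `I`, whose hit sets are bounded, remain.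
  choose W hW using fun a => exists_sum_powerset
    (fun l : Config d n => if l.Nonempty then w a l else 0)
  refine ⟨W, fun X hX a ha c => ?_⟩
  have hW0 : W a ∅ = 0 := by simpa using (hW a ∅).symm
  have fin1 : ∀ l : Config d n, l.Nonempty → Summable fun z : lattice ξ =>
      {y | ∀ m, m ∈ l ↔ a • (y + cellPoint ξ m) ∈ X}.indicator (fun _ => (1 : ℝ))
          ((z : E d) + c) := by
    intro l hl
    refine summable_of_hasFiniteSupport ((finite_lattice_translates ξ (isBounded_hitSet ξ hl ha hX)
      (Bornology.isBounded_singleton (x := c))).subset ?_)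
    intro z hz
    refine ⟨c, rfl, fun m hm => ?_⟩
    have := Set.mem_of_indicator_ne_zero hz
    exact (this m).1 hm
  have fin2 : ∀ l : Config d n, l.Nonempty → Summable fun z : lattice ξ =>
      (hitSet ξ l a X).indicator (fun _ => (1 : ℝ)) ((z : E d) + c) := by
    intro l hl
    refine summable_of_hasFiniteSupport ((finite_lattice_translates ξ (isBounded_hitSet ξ hl ha hX)
      (Bornology.isBounded_singleton (x := c))).subset ?_)
    intro z hz
    exact ⟨c, rfl, Set.mem_of_indicator_ne_zero hz⟩
  simp only [estimate, localAlgorithm, configCount_eq, hitCount, ← tsum_mul_left]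
  rw [← Summable.tsum_finsetSum, ← Summable.tsum_finsetSum]
  · refine tsum_congr fun z => ?_
    set y : E d := (z : E d) + c
    -- `L` is the one configuration seen at `y`, and `I` is hit exactly when `I ⊆ L`. The identity
    -- at `y` is thus the inversion formula at `L`.
    let L : Config d n := Finset.univ.filter fun m => a • (y + cellPoint ξ m) ∈ X
    have h1 : ∀ l : Config d n, {y | ∀ m, m ∈ l ↔ a • (y + cellPoint ξ m) ∈ X}.indicator
        (fun _ => (1 : ℝ)) y = if l = L then 1 else 0 := by
      intro l
      rw [indicator_one_apply]
      refine if_congr ?_ rfl rfl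
      simp [L, Finset.ext_iff]
    have h2 : ∀ l : Config d n, (hitSet ξ l a X).indicator
        (fun _ => (1 : ℝ)) y = if l ⊆ L then 1 else 0 := by
      intro l
      rw [indicator_one_apply]
      refine if_congr ?_ rfl rfl
      simp [L, hitSet, Finset.subset_iff]
    simp only [h1, h2, mul_ite, mul_one, mul_zero]
    have h3 := hW a L
    rw [Finset.sum_filter]
    have h4 : ∑ l : Config d n, (if l.Nonempty then if l = L then w a l else 0 else 0) =
        if L.Nonempty then w a L else 0 := by
      rw [Finset.sum_eq_single L]
      · simp
      · intro b _ hb; simp [hb]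
      · simp
    rw [h4, h3, Finset.sum_filter]
    rw [← Finset.sum_subset (Finset.subset_univ L.powerset)]
    · refine Finset.sum_congr rfl fun I hI => ?_
      rw [if_pos (Finset.mem_powerset.1 hI)]
      split_ifs with h
      · rfl
      · rw [Finset.not_nonempty_iff_eq_empty.1 h, hW0]
    · intro I _ hI
      rw [Finset.mem_powerset] at hI
      simp [hI]
  · intro I hI
    exact (fin2 I (by simpa using hI)).mul_left _
  · intro I hI
    exact (fin1 I (by simpa using hI)).mul_left _

theorem hitCount_eq_finset_sum (ξ : Module.Basis (Fin d) ℝ (E d)) {I : Config d n}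
    (hI : I.Nonempty) {a : ℝ} (ha : 0 < a) {X : Set (E d)} (hX : Bornology.IsBounded X)
    {C : Set (E d)} (hC : Bornology.IsBounded C) :
    ∃ Z : Finset (lattice ξ), (∀ c ∈ C, hitCount ξ I a X c =
      ∑ z ∈ Z, (hitSet ξ I a X).indicator (fun _ => (1 : ℝ)) ((z : E d) + c)) ∧
      ∀ z ∉ Z, ∀ c ∈ C, (z : E d) + c ∉ hitSet ξ I a X := by
  have hf := finite_lattice_translates ξ (isBounded_hitSet ξ hI ha hX) hC
  have h0 : ∀ z ∉ hf.toFinset, ∀ c ∈ C, (z : E d) + c ∉ hitSet ξ I a X := by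
    intro z hz c hc h
    exact hz (hf.mem_toFinset.2 ⟨c, hc, h⟩)
  refine ⟨hf.toFinset, fun c hc => ?_, h0⟩
  refine tsum_eq_sum fun z hz => ?_
  exact Set.indicator_of_notMem (h0 z hz c hc) _

theorem integrable_indicator_hitSet_add (ξ : Module.Basis (Fin d) ℝ (E d)) {I : Config d n}
    (hI : I.Nonempty) {a : ℝ} (ha : 0 < a) {X : Set (E d)} (hX : Bornology.IsBounded X)
    (hXm : MeasurableSet X) (z : E d) :
    Integrable (fun c => (hitSet ξ I a X).indicator (fun _ => (1 : ℝ)) (z + c)) := by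
  have h : Integrable ((hitSet ξ I a X).indicator (fun _ => (1 : ℝ))) :=
    (integrable_indicator_iff (measurableSet_hitSet ξ I a hXm)).2
      (integrableOn_const (isBounded_hitSet ξ hI ha hX).measure_lt_top.ne)
  exact h.comp_add_left z

theorem isBounded_parallelepiped (ξ : Module.Basis (Fin d) ℝ (E d)) :
    Bornology.IsBounded (parallelepiped ξ) := by
  rw [← Module.Basis.coe_parallelepiped]
  exact ξ.parallelepiped.isCompact.isBounded

theorem measurableSet_parallelepiped (ξ : Module.Basis (Fin d) ℝ (E d)) :
    MeasurableSet (parallelepiped ξ) := by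
  rw [← Module.Basis.coe_parallelepiped]
  exact ξ.parallelepiped.isCompact.measurableSet

theorem integrableOn_hitCount (ξ : Module.Basis (Fin d) ℝ (E d)) {I : Config d n}
    (hI : I.Nonempty) {a : ℝ} (ha : 0 < a) {X : Set (E d)} (hX : Bornology.IsBounded X)
    (hXm : MeasurableSet X) :
    IntegrableOn (hitCount ξ I a X) (parallelepiped ξ) := by
  obtain ⟨Z, hZ, -⟩ := hitCount_eq_finset_sum ξ hI ha hX (isBounded_parallelepiped ξ)
  have h : IntegrableOn (fun c => ∑ z ∈ Z, (hitSet ξ I a X).indicator (fun _ => (1 : ℝ))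
      ((z : E d) + c)) (parallelepiped ξ) :=
    integrable_finsetSum _ fun z _ =>
      (integrable_indicator_hitSet_add ξ hI ha hX hXm (z : E d)).integrableOn
  exact h.congr_fun (fun c hc => (hZ c hc).symm) (measurableSet_parallelepiped ξ)

/-- Unfolding: the lattice translates of the half-open cell tile the space, and the closed cell
differs from it by a null set. -/
theorem setIntegral_hitCount (ξ : Module.Basis (Fin d) ℝ (E d)) {I : Config d n}
    (hI : I.Nonempty) {a : ℝ} (ha : 0 < a) {X : Set (E d)} (hX : Bornology.IsBounded X)
    (hXm : MeasurableSet X) :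
    ∫ c in parallelepiped ξ, hitCount ξ I a X c = volume.real (hitSet ξ I a X) := by
  obtain ⟨Z, hZ, hZ'⟩ := hitCount_eq_finset_sum ξ hI ha hX (isBounded_parallelepiped ξ)
  have hsub := ZSpan.fundamentalDomain_subset_parallelepiped ξ
  have hint : Integrable ((hitSet ξ I a X).indicator (fun _ => (1 : ℝ))) := by
    simpa using integrable_indicator_hitSet_add ξ hI ha hX hXm 0
  rw [setIntegral_congr_fun (measurableSet_parallelepiped ξ) hZ,
    ← setIntegral_congr_set (ZSpan.fundamentalDomain_ae_parallelepiped ξ volume),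
    integral_finsetSum]
  swap
  · exact fun z _ => (integrable_indicator_hitSet_add ξ hI ha hX hXm (z : E d)).integrableOn
  have : Countable (Submodule.span ℤ (Set.range ξ)).toAddSubgroup :=
    inferInstanceAs (Countable (Submodule.span ℤ (Set.range ξ)))
  have h : ∫ y, (hitSet ξ I a X).indicator (fun _ => (1 : ℝ)) y = ∑' z : lattice ξ,
      ∫ c in ZSpan.fundamentalDomain ξ,
        (hitSet ξ I a X).indicator (fun _ => (1 : ℝ)) ((z : E d) + c) :=
    (ZSpan.isAddFundamentalDomain' ξ (volume : Measure (E d))).integral_eq_tsum''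
      ((hitSet ξ I a X).indicator (fun _ => (1 : ℝ))) hint
  rw [integral_indicator (measurableSet_hitSet ξ I a hXm)] at h
  simp only [integral_const, smul_eq_mul, mul_one, measureReal_restrict_apply_univ] at h
  rw [h, eq_comm]
  refine tsum_eq_sum fun z hz => ?_
  refine setIntegral_eq_zero_of_forall_eq_zero fun c hc => ?_
  exact Set.indicator_of_notMem (hZ' z hz c (hsub hc)) _

theorem isIntegrableOn_polytopes (ξ : Module.Basis (Fin d) ℝ (E d)) (w : ℝ → Config d n → ℝ) :
    IsIntegrableOn ξ (localAlgorithm ξ w) (polytopes d) := by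
  rintro X ⟨⟨s, hs, rfl⟩, -⟩ a ha
  obtain ⟨W, hW⟩ := exists_estimate_eq_sum_hitCount ξ w
  have hc : IsCompact (convexHull ℝ s) := hs.isCompact_convexHull ℝ
  simp only [hW _ hc.isBounded a ha]
  refine integrable_finsetSum _ fun I hI => Integrable.const_mul ?_ _
  exact integrableOn_hitCount ξ (by simpa using hI) ha hc.isBounded hc.measurableSet

theorem meanEstimate_eq_sum (ξ : Module.Basis (Fin d) ℝ (E d)) (w W : ℝ → Config d n → ℝ)
    (hW : ∀ X : Set (E d), Bornology.IsBounded X → ∀ a : ℝ, 0 < a →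
      ∀ c : E d, estimate ξ (localAlgorithm ξ w) X a c =
        ∑ I : Config d n with I.Nonempty, W a I * hitCount ξ I a X c)
    {X : Set (E d)} (hX : IsCompact X) {a : ℝ} (ha : 0 < a) :
    meanEstimate ξ (localAlgorithm ξ w) X a =
      (volume.real (parallelepiped ξ))⁻¹ * ∑ I : Config d n with I.Nonempty,
        W a I * volume.real (hitSet ξ I a X) := by
  rw [meanEstimate, setAverage_eq, smul_eq_mul]
  simp only [hW _ hX.isBounded a ha]
  rw [integral_finsetSum]
  · congr 1
    refine Finset.sum_congr rfl fun I hI => ?_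
    rw [integral_const_mul, setIntegral_hitCount ξ (by simpa using hI) ha hX.isBounded
      hX.measurableSet]
  · intro I hI
    exact (integrableOn_hitCount ξ (by simpa using hI) ha hX.isBounded
      hX.measurableSet).const_mul _

/-! ### Boxes in a basis and the mean of the estimator on them -/

/-- The box with respect to the basis `b` with coordinates in `[l i, u i]`. -/
def box (b : Module.Basis (Fin d) ℝ (E d)) (l u : Fin d → ℝ) : Set (E d) :=
  {y | ∀ i, b.repr y i ∈ Icc (l i) (u i)}

theorem box_zero_eq_parallelepiped (b : Module.Basis (Fin d) ℝ (E d)) {s : Fin d → ℝ}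
    (hs : ∀ i, 0 ≤ s i) : box b 0 s = parallelepiped (fun i => s i • b i) := by
  ext y
  rw [mem_parallelepiped_iff]
  constructor
  · intro hy
    refine ⟨fun i => b.repr y i / s i, ⟨fun i => div_nonneg (hy i).1 (hs i),
      fun i => div_le_one_of_le₀ (hy i).2 (hs i)⟩, ?_⟩
    conv_lhs => rw [← b.sum_repr y]
    refine Finset.sum_congr rfl fun i _ => ?_
    rw [smul_smul]
    -- On a degenerate side the quotient is `0` by the convention for division by zero, and the
    -- coordinate itself vanishes.
    rcases (hs i).eq_or_lt with h | h
    · have h1 := hy i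
      rw [← h] at h1
      have : b.repr y i = 0 := le_antisymm h1.2 h1.1
      simp [this]
    · rw [div_mul_cancel₀ _ h.ne']
  · rintro ⟨t, ht, rfl⟩ i
    simp only [smul_smul, b.repr_sum_self]
    exact ⟨mul_nonneg (ht.1 i) (hs i), mul_le_of_le_one_left (hs i) (ht.2 i)⟩

theorem box_eq_vadd (b : Module.Basis (Fin d) ℝ (E d)) (l u : Fin d → ℝ) :
    box b l u = (∑ i, l i • b i) +ᵥ box b 0 (u - l) := by
  ext y
  rw [mem_vadd_set_iff_neg_vadd_mem]
  refine forall_congr' fun i => ?_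
  simp only [vadd_eq_add, map_add, map_neg, Finsupp.add_apply, Finsupp.neg_apply,
    b.repr_sum_self, mem_Icc, Pi.zero_apply, Pi.sub_apply]
  constructor <;> rintro ⟨h1, h2⟩ <;> constructor <;> linarith

theorem volume_real_parallelepiped (b : Module.Basis (Fin d) ℝ (E d)) (v : Fin d → E d) :
    volume.real (parallelepiped v) = |b.det v| * volume.real (parallelepiped b) := by
  have h := Measure.addHaarMeasure_unique (volume : Measure (E d)) b.parallelepiped
  have h2 : volume (parallelepiped v) =
      volume (parallelepiped b) * ENNReal.ofReal |b.det v| := by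
    rw [← Measure.addHaar_parallelepiped b v]
    conv_lhs => rw [h]
    rw [Module.Basis.coe_parallelepiped, Measure.smul_apply, smul_eq_mul, Module.Basis.addHaar_def]
  rw [measureReal_def, h2, ENNReal.toReal_mul, ENNReal.toReal_ofReal (abs_nonneg _), mul_comm]
  rfl

theorem volume_real_parallelepiped_pos (b : Module.Basis (Fin d) ℝ (E d)) :
    0 < volume.real (parallelepiped b) := by
  rw [← Module.Basis.coe_parallelepiped]
  refine ENNReal.toReal_pos ?_ b.parallelepiped.isCompact.measure_lt_top.ne
  exact (Measure.measure_pos_of_nonempty_interior _ b.parallelepiped.interior_nonempty).ne'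

theorem volume_real_box (b : Module.Basis (Fin d) ℝ (E d)) {l u : Fin d → ℝ} (h : ∀ i, l i ≤ u i) :
    volume.real (box b l u) = (∏ i, (u i - l i)) * volume.real (parallelepiped b) := by
  have h0 : ∀ i, 0 ≤ (u - l) i := fun i => sub_nonneg.2 (h i)
  rw [box_eq_vadd, measureReal_def, measure_vadd, ← measureReal_def,
    box_zero_eq_parallelepiped b h0, volume_real_parallelepiped b]
  have := b.det.map_smul_univ (u - l) b
  rw [this, b.det_self, smul_eq_mul, mul_one, abs_of_nonneg (Finset.prod_nonneg fun i _ => h0 i)]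
  rfl

theorem isCompact_box (b : Module.Basis (Fin d) ℝ (E d)) (l u : Fin d → ℝ) :
    IsCompact (box b l u) := by
  by_cases h : ∀ i, l i ≤ u i
  · have h0 : ∀ i, 0 ≤ (u - l) i := fun i => sub_nonneg.2 (h i)
    rw [box_eq_vadd, box_zero_eq_parallelepiped b h0]
    refine IsCompact.vadd _ ?_
    rw [parallelepiped]
    exact isCompact_Icc.image (by fun_prop)
  · convert isCompact_empty
    ext y
    simp only [mem_empty_iff_false, iff_false]
    exact fun hy => h fun i => (hy i).1.trans (hy i).2

theorem box_mem_polytopes (b : Module.Basis (Fin d) ℝ (E d)) {l u : Fin d → ℝ}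
    (h : ∀ i, l i < u i) : box b l u ∈ polytopes d := by
  have h0 : ∀ i, 0 < (u - l) i := fun i => sub_pos.2 (h i)
  rw [box_eq_vadd, box_zero_eq_parallelepiped b fun i => (h0 i).le]
  constructor
  · refine ⟨(∑ i, l i • b i) +ᵥ ∑ i, {(0 : E d), (u - l) i • b i}, Finite.vadd_set ?_, ?_⟩
    · refine Finset.sum_induction (fun i => ({(0 : E d), (u - l) i • b i} : Set (E d)))
        Set.Finite (fun _ _ => Set.Finite.add) (Set.finite_singleton _) fun i _ => ?_
      exact Set.toFinite _
    · rw [convexHull_vadd, parallelepiped_eq_convexHull]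
  · rw [interior_vadd]
    refine Set.Nonempty.vadd_set ?_
    have := (b.isUnitSMul (w := u - l) fun i => (h0 i).ne'.isUnit).parallelepiped.interior_nonempty
    rw [Module.Basis.coe_parallelepiped] at this
    have e : (fun i => (u - l) i • b i) = b.isUnitSMul (w := u - l) fun i => (h0 i).ne'.isUnit := by
      funext i
      simp [Module.Basis.isUnitSMul_apply]
    rwa [e]

/-- The least `i`-th coordinate of a pixel of `I`, with respect to the basis `b`. -/
def minCoord (ξ b : Module.Basis (Fin d) ℝ (E d)) (I : Config d n) (i : Fin d) : ℝ :=
  if h : I.Nonempty then I.inf' h fun m => b.repr (cellPoint ξ m) i else 0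

/-- The largest `i`-th coordinate of a pixel of `I`, with respect to the basis `b`. -/
def maxCoord (ξ b : Module.Basis (Fin d) ℝ (E d)) (I : Config d n) (i : Fin d) : ℝ :=
  if h : I.Nonempty then I.sup' h fun m => b.repr (cellPoint ξ m) i else 0

/-- The width of `I` in the `i`-th coordinate of the basis `b`. -/
def width (ξ b : Module.Basis (Fin d) ℝ (E d)) (I : Config d n) (i : Fin d) : ℝ :=
  maxCoord ξ b I i - minCoord ξ b I i

theorem width_eq {ξ b : Module.Basis (Fin d) ℝ (E d)} {I : Config d n} {i : Fin d}
    {p q : Fin d → Fin n} (hp : p ∈ I) (hq : q ∈ I)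
    (hpm : ∀ m ∈ I, b.repr (cellPoint ξ m) i ≤ b.repr (cellPoint ξ p) i)
    (hqm : ∀ m ∈ I, b.repr (cellPoint ξ q) i ≤ b.repr (cellPoint ξ m) i) :
    width ξ b I i = b.repr (cellPoint ξ p) i - b.repr (cellPoint ξ q) i := by
  have hI : I.Nonempty := ⟨p, hp⟩
  rw [width, maxCoord, minCoord, dif_pos hI, dif_pos hI]
  congr 1
  · exact le_antisymm (Finset.sup'_le _ _ hpm) (Finset.le_sup' (fun m => b.repr (cellPoint ξ m) i) hp)
  · exact le_antisymm (Finset.inf'_le (fun m => b.repr (cellPoint ξ m) i) hq) (Finset.le_inf' _ _ hqm)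

/-- A box imposes a separate interval condition on each coordinate, so only the extreme coordinates
of `I` count. -/
theorem hitSet_box (ξ b : Module.Basis (Fin d) ℝ (E d)) {I : Config d n} (hI : I.Nonempty)
    {a : ℝ} (ha : 0 < a) (l u : Fin d → ℝ) :
    hitSet ξ I a (box b l u) =
      box b (fun i => l i / a - minCoord ξ b I i) (fun i => u i / a - maxCoord ξ b I i) := by
  ext y
  simp only [hitSet, box, mem_ofPred_eq, mem_Icc, map_smul, map_add, Finsupp.smul_apply,
    Finsupp.add_apply, smul_eq_mul, minCoord, maxCoord, dif_pos hI]
  rw [show (∀ m ∈ I, ∀ i, l i ≤ a * (b.repr y i + b.repr (cellPoint ξ m) i) ∧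
      a * (b.repr y i + b.repr (cellPoint ξ m) i) ≤ u i) ↔
      ∀ i, ∀ m ∈ I, l i ≤ a * (b.repr y i + b.repr (cellPoint ξ m) i) ∧
      a * (b.repr y i + b.repr (cellPoint ξ m) i) ≤ u i from
    ⟨fun h i m hm => h m hm i, fun h m hm i => h i m hm⟩]
  refine forall_congr' fun i => ?_
  rw [sub_le_comm, le_sub_comm, Finset.le_inf'_iff, Finset.sup'_le_iff, ← forall₂_and]
  refine forall₂_congr fun m _ => ?_
  rw [sub_le_iff_le_add', le_sub_iff_add_le', div_le_iff₀' ha, le_div_iff₀' ha]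

theorem meanEstimate_box (ξ : Module.Basis (Fin d) ℝ (E d)) (w W : ℝ → Config d n → ℝ)
    (hW : ∀ X : Set (E d), Bornology.IsBounded X → ∀ a : ℝ, 0 < a →
      ∀ c : E d, estimate ξ (localAlgorithm ξ w) X a c =
        ∑ I : Config d n with I.Nonempty, W a I * hitCount ξ I a X c)
    (b : Module.Basis (Fin d) ℝ (E d)) {s : Fin d → ℝ} (hs : ∀ i, 0 < s i) :
    ∀ᶠ a in 𝓝[>] (0 : ℝ), meanEstimate ξ (localAlgorithm ξ w) (box b 0 s) a =
      |ξ.det b| * ∑ I : Config d n with I.Nonempty,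
        W a I * ∏ i, (s i * a⁻¹ - width ξ b I i) := by
  -- For small `a` no shrunken side is negative, so each volume is the plain product, without
  -- truncation at `0`.
  have hev : ∀ᶠ a in 𝓝[>] (0 : ℝ), ∀ (I : Config d n) i, width ξ b I i ≤ s i * a⁻¹ := by
    rw [eventually_all]; intro I
    rw [eventually_all]; intro i
    exact (tendsto_inv_nhdsGT_zero.const_mul_atTop (hs i)).eventually_ge_atTop _
  filter_upwards [hev, self_mem_nhdsWithin] with a hw ha
  rw [meanEstimate_eq_sum ξ w W hW (isCompact_box b 0 s) ha, Finset.mul_sum, Finset.mul_sum]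
  refine Finset.sum_congr rfl fun I hI => ?_
  rw [hitSet_box ξ b (by simpa using hI) ha, volume_real_box, volume_real_parallelepiped ξ b]
  · have h1 := volume_real_parallelepiped_pos ξ
    have h2 : ∀ i, (s i / a - maxCoord ξ b I i) - ((0 : Fin d → ℝ) i / a - minCoord ξ b I i)
        = s i * a⁻¹ - width ξ b I i := by
      intro i; rw [width, Pi.zero_apply, div_eq_mul_inv]; ring
    simp only [h2]
    field_simp
  · intro i
    have := hw I i
    rw [width] at this
    rw [Pi.zero_apply, zero_div, div_eq_mul_inv]
    linarith

/-! ### Extraction of the constant coefficient in the side lengths -/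

/-- The interpolation that extracts the constant coefficient of a function of `s ∈ {1, 2}^d` that
is affine in each variable. -/
def extractCoeff (x : Fin d → Fin 2) : ℝ := ∏ i, if x i = 0 then 2 else -1

theorem sum_extractCoeff : ∑ x : Fin d → Fin 2, extractCoeff x = 1 := by
  have := Finset.prod_univ_sum (fun _ : Fin d => (Finset.univ : Finset (Fin 2)))
    (fun _ j => if j = 0 then (2 : ℝ) else -1)
  rw [Fintype.piFinset_univ] at this
  simp only [extractCoeff]
  rw [← this]
  norm_num [Fin.sum_univ_two]

/-- The sum factors over the coordinates, and each factor is `2 (k - t) - (2 k - t) = -t`. -/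
theorem sum_extractCoeff_mul_prod (k : ℝ) (t : Fin d → ℝ) :
    ∑ x : Fin d → Fin 2, extractCoeff x * ∏ i, ((((x i : ℕ) : ℝ) + 1) * k - t i) =
      ∏ i, (-t i) := by
  have := Finset.prod_univ_sum (fun _ : Fin d => (Finset.univ : Finset (Fin 2)))
    (fun i j => (if j = 0 then (2 : ℝ) else -1) * ((((j : ℕ) : ℝ) + 1) * k - t i))
  rw [Fintype.piFinset_univ] at this
  simp only [extractCoeff, ← Finset.prod_mul_distrib]
  rw [← this]
  refine Finset.prod_congr rfl fun i _ => ?_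
  simp only [Fin.sum_univ_two, Fin.val_zero, Fin.val_one, if_true, one_ne_zero, if_false]
  push_cast
  ring

theorem sum_extractCoeff_mul_sum (ξ b : Module.Basis (Fin d) ℝ (E d)) (W : Config d n → ℝ) (k : ℝ) :
    ∑ x : Fin d → Fin 2, extractCoeff x * ∑ I : Config d n with I.Nonempty,
        W I * ∏ i, ((((x i : ℕ) : ℝ) + 1) * k - width ξ b I i) =
      ∑ I : Config d n with I.Nonempty, W I * ∏ i, (-width ξ b I i) := by
  simp only [Finset.mul_sum, mul_left_comm (extractCoeff _)]
  rw [Finset.sum_comm]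
  refine Finset.sum_congr rfl fun I _ => ?_
  rw [← Finset.mul_sum, sum_extractCoeff_mul_prod]

/-- If the means at all boxes with side lengths in `{1, 2}` have the limit `ℓ`, then so does the
part of the mean that does not depend on the side lengths. -/
theorem tendsto_sum_extractCoeff {α : Type*} {F : Filter α} {ℓ : ℝ}
    {G : (Fin d → Fin 2) → α → ℝ}
    (h : ∀ x, Tendsto (G x) F (𝓝 ℓ)) :
    Tendsto (fun a => ∑ x, extractCoeff x * G x a) F (𝓝 ℓ) := by
  have := tendsto_finsetSum Finset.univ fun x _ => (h x).const_mul (extractCoeff x)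
  rwa [← Finset.sum_mul, sum_extractCoeff, one_mul] at this

/-! ### Steiner formula and Euler characteristic of parallelepipeds -/

/-- A nonnegative additive function on `[0, ∞)` is linear. -/
theorem eq_mul_of_additive_of_nonneg {g : ℝ → ℝ} (h0 : ∀ t, 0 ≤ t → 0 ≤ g t)
    (hadd : ∀ s t, 0 ≤ s → 0 ≤ t → g (s + t) = g s + g t) {t : ℝ} (ht : 0 ≤ t) :
    g t = t * g 1 := by
  have hmul : ∀ (t : ℝ), 0 ≤ t → ∀ k : ℕ, g (k * t) = k * g t := by
    intro t ht k
    induction k with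
    | zero =>
      have := hadd 0 0 le_rfl le_rfl
      simp only [Nat.cast_zero, zero_mul, add_zero] at this ⊢
      linarith
    | succ k ih =>
      rw [Nat.cast_succ, add_mul, one_mul, hadd _ _ (by positivity) ht, ih]
      ring
  have hmono : ∀ s t, 0 ≤ s → s ≤ t → g s ≤ g t := by
    intro s t hs hst
    have := hadd s (t - s) hs (sub_nonneg.2 hst)
    rw [add_sub_cancel] at this
    linarith [h0 (t - s) (sub_nonneg.2 hst)]
  -- Both `g (N t)` and `N t * g 1` lie between `⌊N t⌋ * g 1` and `(⌊N t⌋ + 1) * g 1`; the bound is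
  -- uniform in `N`.
  have key : ∀ N : ℕ, (N : ℝ) * |g t - t * g 1| ≤ g 1 := by
    intro N
    have h1 := Nat.floor_le (mul_nonneg N.cast_nonneg ht)
    have h2 := (Nat.lt_floor_add_one ((N : ℝ) * t)).le
    have h3 := hmono _ _ (Nat.cast_nonneg _) h1
    have h4 := hmono _ _ (by positivity) h2
    rw [hmul t ht] at h3 h4
    have h5 := hmul 1 zero_le_one ⌊(N : ℝ) * t⌋₊
    have h6 := hmul 1 zero_le_one (⌊(N : ℝ) * t⌋₊ + 1)
    rw [mul_one] at h5 h6
    push_cast at h6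
    rw [h5] at h3
    rw [h6] at h4
    have h7 := h0 1 zero_le_one
    have h8 := mul_le_mul_of_nonneg_right h1 h7
    have h9 := mul_le_mul_of_nonneg_right h2 h7
    rw [← abs_of_nonneg (N.cast_nonneg : (0 : ℝ) ≤ N), ← abs_mul, abs_le]
    constructor <;> nlinarith
  by_contra hne
  have hpos : 0 < |g t - t * g 1| := abs_pos.2 (sub_ne_zero.2 hne)
  obtain ⟨N, hN⟩ := exists_nat_gt (g 1 / |g t - t * g 1|)
  rw [div_lt_iff₀ hpos] at hN
  exact absurd (key N) (not_le.2 hN)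

theorem mem_add_segment {K : Set (E d)} {v x : E d} {t : ℝ} (ht : 0 ≤ t) :
    x ∈ K + segment ℝ 0 (t • v) ↔ ∃ k ∈ K, ∃ τ ∈ Icc 0 t, x = k + τ • v := by
  have : segment ℝ 0 (t • v) = (fun τ : ℝ => τ • v) '' Icc 0 t := by
    rw [segment_eq_image']
    ext y
    constructor
    · rintro ⟨θ, hθ, rfl⟩
      exact ⟨θ * t, ⟨mul_nonneg hθ.1 ht, mul_le_of_le_one_left ht hθ.2⟩, by simp [mul_smul]⟩
    · rintro ⟨τ, hτ, rfl⟩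
      rcases ht.eq_or_lt with h | h
      · refine ⟨0, by simp, ?_⟩
        have : τ = 0 := le_antisymm (h ▸ hτ.2) hτ.1
        simp [this]
      · refine ⟨τ / t, ⟨div_nonneg hτ.1 ht, div_le_one_of_le₀ hτ.2 ht⟩, ?_⟩
        simp [smul_smul, div_mul_cancel₀ _ h.ne']
  rw [this, Set.mem_add]
  simp only [exists_mem_image, eq_comm]

/-- What is newly swept when the segment grows from length `s` to `s + t` is a translate of what is
swept from `0` to `t`. This makes the swept volume additive in the length. -/
theorem add_segment_diff {K : Set (E d)} (hK : Convex ℝ K) (v : E d) {s t : ℝ} (hs : 0 ≤ s)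
    (ht : 0 ≤ t) :
    (K + segment ℝ 0 ((s + t) • v)) \ (K + segment ℝ 0 (s • v)) =
      (s • v) +ᵥ ((K + segment ℝ 0 (t • v)) \ K) := by
  ext y
  rw [mem_vadd_set_iff_neg_vadd_mem, Set.mem_sdiff, Set.mem_sdiff, mem_add_segment (add_nonneg hs ht),
    mem_add_segment hs, mem_add_segment ht, vadd_eq_add]
  constructor
  · rintro ⟨⟨k, hk, τ, hτ, rfl⟩, hy⟩
    have hsτ : s < τ := by
      by_contra h
      exact hy ⟨k, hk, τ, ⟨hτ.1, not_lt.1 h⟩, rfl⟩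
    refine ⟨⟨k, hk, τ - s, ⟨by linarith, by linarith [hτ.2]⟩, ?_⟩, fun h => ?_⟩
    · rw [sub_smul]; abel
    · exact hy ⟨_, h, s, ⟨hs, le_rfl⟩, by abel⟩
  · rintro ⟨⟨k, hk, τ, hτ, hy⟩, hyK⟩
    have hy' : y = k + (τ + s) • v := by
      rw [add_smul, ← add_assoc, ← hy]; abel
    refine ⟨⟨k, hk, τ + s, ⟨by linarith [hτ.1], by linarith [hτ.2]⟩, hy'⟩, ?_⟩
    rintro ⟨k', hk', τ', hτ', h'⟩
    refine hyK ?_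
    rw [hy]
    rcases hτ.1.eq_or_lt with h0 | h0
    · rwa [← h0, zero_smul, add_zero]
    -- If the point were already swept at time `τ' ≤ s`, then `k + τ • v` would lie on the segment
    -- from `k` to `k'`, hence in `K` by convexity.
    have hδ : 0 < τ + (s - τ') := by linarith [hτ'.2]
    have hkk : k' = k + (τ + (s - τ')) • v := by
      have : k' + τ' • v = k + (τ + s) • v := h'.symm.trans hy'
      rw [eq_sub_of_add_eq this]
      module
    have := hK hk hk' (a := (s - τ') / (τ + (s - τ'))) (b := τ / (τ + (s - τ')))
      (div_nonneg (by linarith [hτ'.2]) hδ.le) (div_nonneg h0.le hδ.le)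
      (by rw [← add_div, add_comm]; exact div_self hδ.ne')
    convert this using 1
    rw [hkk, smul_add, smul_smul, div_mul_cancel₀ _ hδ.ne', ← add_assoc, ← add_smul, ← add_div,
      add_comm (s - τ') τ, div_self hδ.ne', one_smul]

theorem isCompact_segment (v : E d) : IsCompact (segment ℝ 0 v) := by
  rw [segment_eq_image']
  exact isCompact_Icc.image (by fun_prop)

/-- The volume of the sum of a convex body and a segment is affine in the length of the segment. -/
theorem volume_real_add_segment {K : Set (E d)} (hK : Convex ℝ K) (hKc : IsCompact K) (v : E d)
    {t : ℝ} (ht : 0 ≤ t) :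
    volume.real (K + segment ℝ 0 (t • v)) =
      t * volume.real (K + segment ℝ 0 v) + (1 - t) * volume.real K := by
  have hc : ∀ t : ℝ, IsCompact (K + segment ℝ 0 (t • v)) :=
    fun t => hKc.add (isCompact_segment _)
  have hfin : ∀ t : ℝ, volume (K + segment ℝ 0 (t • v)) ≠ ⊤ := fun t => (hc t).measure_lt_top.ne
  have hzero : K + segment ℝ 0 ((0 : ℝ) • v) = K := by simp
  have hdiff : ∀ s t : ℝ, 0 ≤ s → 0 ≤ t → volume.real (K + segment ℝ 0 ((s + t) • v)) -
      volume.real (K + segment ℝ 0 (s • v)) =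
      volume.real ((K + segment ℝ 0 (t • v)) \ K) := by
    intro s t hs ht
    rw [← measureReal_sdiff _ (hc s).measurableSet (hfin (s + t)), add_segment_diff hK v hs ht,
      measureReal_def, measure_vadd, ← measureReal_def]
    intro x hx
    rw [mem_add_segment hs] at hx
    rw [mem_add_segment (add_nonneg hs ht)]
    obtain ⟨k, hk, τ, hτ, rfl⟩ := hx
    exact ⟨k, hk, τ, ⟨hτ.1, hτ.2.trans (by linarith)⟩, rfl⟩
  have := eq_mul_of_additive_of_nonneg
    (g := fun t => volume.real ((K + segment ℝ 0 (t • v)) \ K)) (fun t _ => measureReal_nonneg)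
    (fun s t hs ht => by
      have h1 := hdiff 0 (s + t) le_rfl (add_nonneg hs ht)
      have h2 := hdiff 0 s le_rfl hs
      have h3 := hdiff s t hs ht
      rw [zero_add] at h1 h2
      linarith) ht
  have h1 := hdiff 0 t le_rfl ht
  have h2 := hdiff 0 1 le_rfl zero_le_one
  rw [zero_add, hzero] at h1 h2
  rw [one_smul] at this h2
  nlinarith

/-- Interpolation of a function that is affine in each of finitely many nonnegative variables. -/
theorem eq_sum_of_affine {ι : Type*} [DecidableEq ι] (g : (ι → ℝ) → ℝ)
    (hg : ∀ (t : ι → ℝ), (∀ i, 0 ≤ t i) → ∀ i, g t =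
      t i * g (Function.update t i 1) + (1 - t i) * g (Function.update t i 0))
    (A : Finset ι) (t : ι → ℝ) (ht : ∀ i, 0 ≤ t i) :
    g t = ∑ T ∈ A.powerset, (∏ i ∈ T, t i) * (∏ i ∈ A \ T, (1 - t i)) *
      g (fun i => if i ∈ A then if i ∈ T then 1 else 0 else t i) := by
  -- `A` collects the variables already replaced by the values `0` and `1`.
  induction A using Finset.induction_on with
  | empty => simp
  | insert j A hj ih =>
    rw [Finset.sum_powerset_insert hj, ← Finset.sum_add_distrib, ih]
    refine Finset.sum_congr rfl fun T hT => ?_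
    have hTA := Finset.mem_powerset.1 hT
    have hjT : j ∉ T := fun h => hj (hTA h)
    rw [hg (fun i => if i ∈ A then if i ∈ T then 1 else 0 else t i)
      (fun i => by split_ifs <;> simp [ht]) j]
    have e1 : insert j A \ T = insert j (A \ T) := Finset.insert_sdiff_of_notMem _ hjT
    have e2 : insert j A \ insert j T = A \ T := by
      ext i
      simp only [Finset.mem_sdiff, Finset.mem_insert]
      constructor
      · rintro ⟨h1 | h1, h2⟩
        · exact absurd (Or.inl h1) h2
        · exact ⟨h1, fun h => h2 (Or.inr h)⟩
      · rintro ⟨h1, h2⟩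
        refine ⟨Or.inr h1, ?_⟩
        rintro (h | h)
        · exact hj (h ▸ h1)
        · exact h2 h
    rw [e1, e2, Finset.prod_insert (by simp [hj]), Finset.prod_insert hjT]
    have e3 : Function.update (fun i => if i ∈ A then if i ∈ T then 1 else 0 else t i) j 0 =
        fun i => if i ∈ insert j A then if i ∈ T then 1 else 0 else t i := by
      funext i
      by_cases h : i = j
      · subst h; simp [hjT]
      · simp [h]
    have e4 : Function.update (fun i => if i ∈ A then if i ∈ T then 1 else 0 else t i) j 1 =
        fun i => if i ∈ insert j A then if i ∈ insert j T then 1 else 0 else t i := by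
      funext i
      by_cases h : i = j
      · subst h; simp
      · simp [h]
    rw [e3, e4, if_neg hj]
    ring

/-- The volume of the sum of the unit ball and a parallelepiped. -/
def thickVolume (v : Fin d → E d) (t : Fin d → ℝ) : ℝ :=
  volume.real (Metric.closedBall (0 : E d) 1 + parallelepiped fun i => t i • v i)

theorem thickVolume_affine (v : Fin d → E d) (t : Fin d → ℝ) (ht : ∀ i, 0 ≤ t i) (i : Fin d) :
    thickVolume v t =
      t i * thickVolume v (Function.update t i 1) +
        (1 - t i) * thickVolume v (Function.update t i 0) := by
  set K : Set (E d) := Metric.closedBall (0 : E d) 1 +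
    ∑ j ∈ Finset.univ.erase i, segment ℝ 0 (t j • v j) with hKdef
  have hsum : ∀ c : ℝ, thickVolume v (Function.update t i c) =
      volume.real (K + segment ℝ 0 (c • v i)) := by
    intro c
    rw [thickVolume, parallelepiped_eq_sum_segment, hKdef,
      ← Finset.sum_erase_add _ _ (Finset.mem_univ i), add_assoc]
    congr 3
    · refine Finset.sum_congr rfl fun j hj => ?_
      rw [Function.update_of_ne (Finset.ne_of_mem_erase hj)]
    · rw [Function.update_self]
  have hKc : IsCompact K := by
    refine (isCompact_closedBall _ _).add ?_
    refine Finset.sum_induction (fun j => segment ℝ 0 (t j • v j)) IsCompact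
      (fun _ _ => IsCompact.add) ?_ fun j _ => isCompact_segment _
    exact isCompact_singleton
  have hK : Convex ℝ K := by
    refine (convex_closedBall _ _).add ?_
    refine Finset.sum_induction (fun j => segment ℝ 0 (t j • v j)) (Convex ℝ)
      (fun _ _ => Convex.add) ?_ fun j _ => convex_segment _ _
    exact convex_singleton _
  have h := volume_real_add_segment hK hKc (v i) (ht i)
  rw [← hsum, Function.update_eq_self] at h
  rw [h, hsum 1, hsum 0]
  simp

theorem isCompact_parallelepiped (v : Fin d → E d) : IsCompact (parallelepiped v) := by
  rw [parallelepiped]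
  exact isCompact_Icc.image (by fun_prop)

theorem parallelepiped_smul (v : Fin d → E d) (r : ℝ) :
    parallelepiped (fun i => r • v i) = r • parallelepiped v := by
  have := image_parallelepiped (r • (LinearMap.id : E d →ₗ[ℝ] E d)) v
  exact this.symm

/-- Scaling by `r` turns the ball into the unit ball and the edge lengths into `r⁻¹`. The
interpolation formula in these lengths, multiplied by `r ^ d`, is a polynomial in `r`. -/
theorem volume_real_parallelepiped_add_closedBall (v : Fin d → E d) {r : ℝ} (hr : 0 < r) :
    volume.real (parallelepiped v + Metric.closedBall (0 : E d) r) =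
      ∑ T : Finset (Fin d), (r - 1) ^ (d - T.card) *
        thickVolume v (fun i => if i ∈ T then 1 else 0) := by
  have e : parallelepiped v + Metric.closedBall (0 : E d) r =
      r • (Metric.closedBall (0 : E d) 1 + parallelepiped fun i => r⁻¹ • v i) := by
    rw [smul_add, parallelepiped_smul, smul_smul, mul_inv_cancel₀ hr.ne', one_smul, add_comm,
      smul_unitClosedBall_of_nonneg hr.le]
  have h := eq_sum_of_affine (thickVolume v) (thickVolume_affine v) Finset.univ (fun _ => r⁻¹)
    (fun _ => (inv_pos.2 hr).le)
  rw [e, measureReal_def, Measure.addHaar_smul, ENNReal.toReal_mul, ← measureReal_def]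
  change _ * thickVolume v (fun _ => r⁻¹) = _
  rw [h, finrank_euclideanSpace_fin, ENNReal.toReal_ofReal (abs_nonneg _),
    abs_of_pos (pow_pos hr d), Finset.mul_sum, Finset.powerset_univ]
  refine Finset.sum_congr rfl fun T _ => ?_
  simp only [Finset.mem_univ, if_true, Finset.prod_const]
  rw [← mul_assoc]
  congr 1
  have hc : (Finset.univ \ T).card = d - T.card := by
    rw [Finset.card_sdiff_of_subset (Finset.subset_univ T), Finset.card_univ, Fintype.card_fin]
  have hle : T.card ≤ d := by simpa using T.card_le_univ
  rw [hc]
  have : r ^ d = r ^ T.card * r ^ (d - T.card) := by rw [← pow_add, Nat.add_sub_cancel' hle]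
  rw [this, mul_mul_mul_comm, ← mul_pow, ← mul_pow, mul_inv_cancel₀ hr.ne', one_pow, one_mul,
    mul_sub, mul_one, mul_inv_cancel₀ hr.ne']

theorem ballVolume_pos (k : ℕ) : 0 < ballVolume k :=
  ENNReal.toReal_pos (Metric.measure_closedBall_pos _ _ one_pos).ne'
    (isCompact_closedBall _ _).measure_lt_top.ne

-- `V 0` is, up to the nonzero factor `ballVolume d`, the coefficient of `r ^ d` in a polynomial
-- known at infinitely many points.
open Polynomial in
theorem eq_of_isSteiner {X : Set (E d)} {V V' : Fin (d + 1) → ℝ} (h : IsSteiner X V)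
    (h' : IsSteiner X V') : V 0 = V' 0 := by
  let p : (Fin (d + 1) → ℝ) → ℝ[X] := fun V =>
    ∑ q : Fin (d + 1), C (ballVolume (d - (q : ℕ)) * V q) * Polynomial.X ^ (d - (q : ℕ))
  have hp : ∀ V r, (p V).eval r =
      ∑ q : Fin (d + 1), r ^ (d - (q : ℕ)) * ballVolume (d - (q : ℕ)) * V q := by
    intro V r
    simp only [p, eval_finsetSum, eval_mul, eval_C, eval_pow, eval_X]
    exact Finset.sum_congr rfl fun q _ => by ring
  have hpp : p V = p V' := by
    refine eq_of_infinite_eval_eq _ _ ((Set.Ici_infinite (0 : ℝ)).mono fun r hr => ?_)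
    simp only [mem_ofPred_eq, hp, ← h r hr, ← h' r hr]
  have hcoeff : ∀ V, (p V).coeff d = ballVolume d * V 0 := by
    intro V
    simp only [p, finsetSum_coeff, coeff_C_mul, coeff_X_pow]
    rw [Finset.sum_eq_single 0]
    · simp
    · intro q _ hq
      have : 0 < (q : ℕ) := Nat.pos_of_ne_zero fun h => hq (Fin.ext h)
      rw [if_neg (by omega), mul_zero]
    · simp
  have := hcoeff V
  rw [hpp, hcoeff] at this
  exact (mul_left_cancel₀ (ballVolume_pos d).ne' this).symm

theorem eulerChar_eq_of_isSteiner {X : Set (E d)} {V : Fin (d + 1) → ℝ} (h : IsSteiner X V) :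
    eulerChar X = V 0 := by
  have hex : ∃ V : Fin (d + 1) → ℝ, IsSteiner X V := ⟨V, h⟩
  rw [eulerChar, intrinsicVolume, dif_pos hex]
  exact eq_of_isSteiner hex.choose_spec h

-- Only `T = ∅` contributes to the coefficient of `r ^ d`. Its term is `(r - 1) ^ d` times the
-- volume of the unit ball, whence `V 0 = 1`.
open Polynomial in
theorem exists_isSteiner_parallelepiped (v : Fin d → E d) :
    ∃ V : Fin (d + 1) → ℝ, IsSteiner (parallelepiped v) V ∧ V 0 = 1 := by
  let p : ℝ[X] := ∑ T : Finset (Fin d), (Polynomial.X - C 1) ^ (d - T.card) *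
    C (thickVolume v (fun i => if i ∈ T then 1 else 0))
  have hdeg : p.natDegree < d + 1 := by
    refine Nat.lt_succ_of_le (natDegree_sum_le_of_forall_le _ _ fun T _ => ?_)
    refine natDegree_mul_C_le _ _ |>.trans ?_
    rw [natDegree_pow, natDegree_X_sub_C, mul_one]
    exact Nat.sub_le _ _
  have hcoeff : p.coeff d = ballVolume d := by
    simp only [p, finsetSum_coeff, coeff_mul_C]
    rw [Finset.sum_eq_single ∅]
    · have hm : ((Polynomial.X - C (1 : ℝ)) ^ (d - (∅ : Finset (Fin d)).card)).coeff d = 1 := by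
        have := ((monic_X_sub_C (1 : ℝ)).pow d).coeff_natDegree
        rwa [natDegree_pow, natDegree_X_sub_C, mul_one] at this
      rw [hm, one_mul]
      simp only [thickVolume, Finset.notMem_empty, if_false, zero_smul]
      rw [parallelepiped_eq_sum_segment]
      simp only [segment_same]
      have : (∑ _i : Fin d, ({0} : Set (E d))) = 0 := Finset.sum_const_zero
      rw [this, add_zero]
      rfl
    · intro T _ hT
      have : 0 < T.card := Finset.card_pos.2 (Finset.nonempty_iff_ne_empty.2 hT)
      have hle : T.card ≤ d := by simpa using T.card_le_univ
      rw [coeff_eq_zero_of_natDegree_lt, zero_mul]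
      rw [natDegree_pow, natDegree_X_sub_C, mul_one]
      omega
    · simp
  have hpos : ∀ r : ℝ, 0 < r →
      volume.real (parallelepiped v + Metric.closedBall (0 : E d) r) = p.eval r := by
    intro r hr
    rw [volume_real_parallelepiped_add_closedBall v hr]
    simp [p, eval_finsetSum]
  have hc := isCompact_parallelepiped v
  have hall : ∀ r : ℝ, 0 ≤ r →
      volume.real (parallelepiped v + Metric.closedBall (0 : E d) r) = p.eval r := by
    intro r hr
    -- The scaling argument needs `r > 0`; the value at `0` follows because volumes of closed
    -- thickenings of a compact set converge to its volume.
    rcases hr.eq_or_lt with rfl | hr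
    · have h1 : Tendsto (fun r => volume.real (parallelepiped v + Metric.closedBall (0 : E d) r))
          (𝓝[>] 0) (𝓝 (volume.real (parallelepiped v + Metric.closedBall (0 : E d) 0))) := by
        have h2 := tendsto_measure_cthickening_of_isCompact (μ := volume) hc
        have h3 := (ENNReal.tendsto_toReal hc.measure_lt_top.ne).comp
          (h2.mono_left (nhdsWithin_le_nhds (s := Ioi 0)))
        rw [Metric.closedBall_zero, Set.singleton_zero, add_zero]
        refine h3.congr' ?_
        filter_upwards [self_mem_nhdsWithin] with r hr
        have : Metric.cthickening r (parallelepiped v) =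
            parallelepiped v + Metric.closedBall 0 r := by
          rw [_root_.IsCompact.cthickening_eq_biUnion_closedBall hc (le_of_lt hr),
            ← vadd_eq_add, ← Set.iUnion_vadd_set]
          simp
        rw [Function.comp_apply, this]
        rfl
      have h4 : Tendsto (fun r => p.eval r) (𝓝[>] 0) (𝓝 (p.eval 0)) :=
        p.continuous.continuousAt.tendsto.mono_left nhdsWithin_le_nhds
      refine tendsto_nhds_unique (h1.congr' ?_) h4
      filter_upwards [self_mem_nhdsWithin] with r hr
      exact hpos r hr
    · exact hpos r hr
  refine ⟨fun q => p.coeff (d - q) / ballVolume (d - q), fun r hr => ?_, ?_⟩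
  · refine (hall r hr).trans ?_
    rw [eval_eq_sum_range' hdeg, ← Fin.sum_univ_eq_sum_range (fun i => p.coeff i * r ^ i),
      ← Equiv.sum_comp Fin.revPerm]
    refine Finset.sum_congr rfl fun q _ => ?_
    have : ((Fin.revPerm q : Fin (d + 1)) : ℕ) = d - q := by
      simp [Fin.val_rev]
    rw [this, mul_assoc, mul_div_cancel₀ _ (ballVolume_pos _).ne', mul_comm]
  · simp [hcoeff, (ballVolume_pos d).ne']

theorem eulerChar_box (b : Module.Basis (Fin d) ℝ (E d)) {l u : Fin d → ℝ} (h : ∀ i, l i ≤ u i) :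
    eulerChar (box b l u) = 1 := by
  rw [box_eq_vadd, box_zero_eq_parallelepiped b (s := u - l) fun i => sub_nonneg.2 (h i)]
  obtain ⟨V, hV, hV0⟩ := exists_isSteiner_parallelepiped fun i => (u - l) i • b i
  rw [← hV0]
  refine eulerChar_eq_of_isSteiner fun r hr => ?_
  rw [← hV r hr, vadd_add_assoc, measure_vadd]

theorem repr_cellPoint (ξ : Module.Basis (Fin d) ℝ (E d)) (m : Fin d → Fin n) (i : Fin d) :
    ξ.repr (cellPoint ξ m) i = ((m i : ℕ) : ℝ) := by
  rw [cellPoint, ξ.repr_sum_self]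

theorem cellPoint_mem_lattice (ξ : Module.Basis (Fin d) ℝ (E d)) (m : Fin d → Fin n) :
    cellPoint ξ m ∈ lattice ξ := by
  rw [lattice, ξ.mem_span_iff_repr_mem ℤ]
  intro i
  exact ⟨((m i : ℕ) : ℤ), by simp [repr_cellPoint]⟩

/-! ### Unimodular changes of the lattice basis -/

theorem shear_aux (b : Module.Basis (Fin d) ℝ (E d)) {i j : Fin d} (hij : i ≠ j) (c : ℤ) :
    ((c : ℝ) • b.coord i) (b j) = 0 := by
  simp [hij.symm]

/-- The basis obtained from `b` by adding `c • b j` to `b i`. -/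
def shear (b : Module.Basis (Fin d) ℝ (E d)) {i j : Fin d} (hij : i ≠ j) (c : ℤ) :
    Module.Basis (Fin d) ℝ (E d) :=
  b.map (LinearEquiv.transvection (shear_aux b hij c))

theorem shear_apply (b : Module.Basis (Fin d) ℝ (E d)) {i j : Fin d} (hij : i ≠ j) (c : ℤ)
    (k : Fin d) : shear b hij c k = b k + (if k = i then (c : ℝ) else 0) • b j := by
  rw [shear, Module.Basis.map_apply, LinearEquiv.transvection.apply]
  congr 2
  simp [Finsupp.single_apply]

theorem shear_repr_of_ne (b : Module.Basis (Fin d) ℝ (E d)) {i j : Fin d} (hij : i ≠ j) (c : ℤ)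
    (x : E d) {k : Fin d} (hk : k ≠ j) : (shear b hij c).repr x k = b.repr x k := by
  rw [shear, Module.Basis.map_repr, LinearEquiv.trans_apply, LinearEquiv.transvection.symm_eq (shear_aux b hij c)
      (by rw [map_neg, shear_aux b hij c, neg_zero]),
    LinearEquiv.transvection.apply]
  simp [hk.symm]

/-- Coordinates change contragrediently: `b i` gains `c • b j`, so the `j`-th coordinate loses `c`
times the `i`-th, and no other coordinate changes. -/
theorem shear_repr_self (b : Module.Basis (Fin d) ℝ (E d)) {i j : Fin d} (hij : i ≠ j) (c : ℤ)
    (x : E d) : (shear b hij c).repr x j = b.repr x j - c * b.repr x i := by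
  rw [shear, Module.Basis.map_repr, LinearEquiv.trans_apply, LinearEquiv.transvection.symm_eq (shear_aux b hij c)
      (by rw [map_neg, shear_aux b hij c, neg_zero]),
    LinearEquiv.transvection.apply]
  simp [sub_eq_add_neg]

theorem lattice_shear (b : Module.Basis (Fin d) ℝ (E d)) {i j : Fin d} (hij : i ≠ j) (c : ℤ) :
    lattice (shear b hij c) = lattice b := by
  apply le_antisymm
  · refine Submodule.span_le.2 ?_
    rintro _ ⟨k, rfl⟩
    rw [shear_apply]
    refine (lattice b).add_mem (Submodule.subset_span ⟨k, rfl⟩) ?_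
    split_ifs
    · rw [Int.cast_smul_eq_zsmul]
      exact (lattice b).smul_mem _ (Submodule.subset_span ⟨j, rfl⟩)
    · simp
  · refine Submodule.span_le.2 ?_
    have hj : b j ∈ lattice (shear b hij c) := by
      refine Submodule.subset_span ⟨j, ?_⟩
      simp [shear_apply, hij.symm]
    rintro _ ⟨k, rfl⟩
    have : b k = shear b hij c k - (if k = i then (c : ℝ) else 0) • b j := by
      rw [shear_apply, add_sub_cancel_right]
    rw [this]
    refine (lattice _).sub_mem (Submodule.subset_span ⟨k, rfl⟩) ?_
    split_ifs
    · rw [Int.cast_smul_eq_zsmul]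
      exact (lattice _).smul_mem _ hj
    · simp

theorem det_shear (ξ b : Module.Basis (Fin d) ℝ (E d)) {i j : Fin d} (hij : i ≠ j) (c : ℤ) :
    ξ.det (shear b hij c) = ξ.det b := by
  have h := Module.Basis.det_comp ξ
    (LinearEquiv.transvection (shear_aux b hij c) : E d →ₗ[ℝ] E d) b
  have hd := LinearEquiv.transvection.det_eq_one (shear_aux b hij c)
  rw [← LinearEquiv.coe_det, hd, Units.val_one, one_mul] at h
  rw [← h]
  rfl

/-! ### Lattice points in boxes -/

theorem tsum_lattice {b : Module.Basis (Fin d) ℝ (E d)} {L : Submodule ℤ (E d)}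
    (h : lattice b = L) (f : E d → ℝ) :
    ∑' z : L, f z = ∑' m : Fin d → ℤ, f (∑ i, (m i : ℝ) • b i) := by
  subst h
  change ∑' z : Submodule.span ℤ (Set.range b), f z = _
  rw [← Equiv.tsum_eq (b.restrictScalars ℤ).equivFun.symm.toEquiv]
  refine tsum_congr fun m => ?_
  congr 1
  simp only [LinearEquiv.coe_toEquiv, Module.Basis.equivFun_symm_apply]
  push_cast
  refine Finset.sum_congr rfl fun i _ => ?_
  rw [Module.Basis.restrictScalars_apply, Int.cast_smul_eq_zsmul]

theorem exists_int_minCoord {ξ b : Module.Basis (Fin d) ℝ (E d)} (h : lattice b = lattice ξ)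
    (I : Config d n) (i : Fin d) : ∃ k : ℤ, minCoord ξ b I i = k := by
  rw [minCoord]
  split_ifs with hI
  · obtain ⟨m, -, hm⟩ := I.exists_mem_eq_inf' hI fun m => b.repr (cellPoint ξ m) i
    have := cellPoint_mem_lattice ξ m
    rw [← h, lattice, b.mem_span_iff_repr_mem ℤ] at this
    obtain ⟨k, hk⟩ := this i
    exact ⟨k, by rw [hm, ← hk]; simp⟩
  · exact ⟨0, by simp⟩

theorem exists_int_maxCoord {ξ b : Module.Basis (Fin d) ℝ (E d)} (h : lattice b = lattice ξ)
    (I : Config d n) (i : Fin d) : ∃ k : ℤ, maxCoord ξ b I i = k := by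
  rw [maxCoord]
  split_ifs with hI
  · obtain ⟨m, -, hm⟩ := I.exists_mem_eq_sup' hI fun m => b.repr (cellPoint ξ m) i
    have := cellPoint_mem_lattice ξ m
    rw [← h, lattice, b.mem_span_iff_repr_mem ℤ] at this
    obtain ⟨k, hk⟩ := this i
    exact ⟨k, by rw [hm, ← hk]; simp⟩
  · exact ⟨0, by simp⟩

/-- The hits of `I` in a box with integral side lengths whose facets stay away from the lattice. -/
theorem hitCount_box {ξ b : Module.Basis (Fin d) ℝ (E d)} (h : lattice b = lattice ξ)
    {I : Config d n} (hI : I.Nonempty) (s : Fin d → ℕ) (j : ℕ)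
    (hw : ∀ i, width ξ b I i ≤ s i * (2 * j + 1)) :
    hitCount ξ I (2 * j + 1 : ℝ)⁻¹ (box b (fun _ => 1 / 2) (fun i => s i + 1 / 2)) 0 =
      ∏ i, (s i * (2 * j + 1 : ℝ) - width ξ b I i) := by
  choose lo hlo using exists_int_minCoord h I
  choose hi hhi using exists_int_maxCoord h I
  have hpos : (0 : ℝ) < (2 * j + 1 : ℝ)⁻¹ := by positivity
  rw [hitCount, hitSet_box ξ b hI hpos]
  simp only [add_zero]
  rw [tsum_lattice h]
  -- After scaling by `2 j + 1` the facets sit at the half-integers `j + 1/2` and `s i * (2 j + 1) +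
  -- j + 1/2`, and `lo`, `hi` are integers. Hence the number of integers in each interval equals its
  -- length.
  set Z : Finset (Fin d → ℤ) := Fintype.piFinset fun i =>
    Finset.Icc (j + 1 - lo i) (s i * (2 * j + 1) + j - hi i) with hZ
  have hmem : ∀ m : Fin d → ℤ, (∑ i, (m i : ℝ) • b i) ∈
      box b (fun i => 1 / 2 / (2 * j + 1 : ℝ)⁻¹ - minCoord ξ b I i)
        (fun i => (s i + 1 / 2) / (2 * j + 1 : ℝ)⁻¹ - maxCoord ξ b I i) ↔ m ∈ Z := by
    intro m
    rw [hZ, Fintype.mem_piFinset]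
    refine forall_congr' fun i => ?_
    simp only [b.repr_sum_self, Finset.mem_Icc, mem_Icc, div_inv_eq_mul, hlo, hhi]
    refine and_congr ?_ ?_
    · constructor
      · intro h
        have : (j : ℝ) - lo i < m i := by linarith
        have : (j : ℤ) - lo i < m i := by exact_mod_cast this
        omega
      · intro h
        have : (j : ℝ) + 1 - lo i ≤ m i := by exact_mod_cast h
        linarith
    · constructor
      · intro h
        have : (m i : ℝ) < s i * (2 * j + 1) + j - hi i + 1 := by linarith
        have : m i < s i * (2 * j + 1) + j - hi i + 1 := by exact_mod_cast this
        linarith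
      · intro h
        have : (m i : ℝ) ≤ s i * (2 * j + 1) + j - hi i := by exact_mod_cast h
        linarith
  rw [tsum_eq_sum (s := Z) fun m hm => Set.indicator_of_notMem (fun h => hm ((hmem m).1 h)) _,
    Finset.sum_congr rfl fun m hm => Set.indicator_of_mem ((hmem m).2 hm) _,
    Finset.sum_const, nsmul_eq_mul, mul_one, hZ, Fintype.card_piFinset]
  push_cast
  refine Finset.prod_congr rfl fun i _ => ?_
  rw [Int.card_Icc]
  have h1 := hw i
  rw [width, hlo, hhi] at h1 ⊢
  have h2 : hi i - lo i ≤ s i * (2 * j + 1) := by exact_mod_cast h1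
  have h3 : ((Int.toNat (s i * (2 * j + 1) + j - hi i + 1 - (j + 1 - lo i)) : ℕ) : ℤ) =
      s i * (2 * j + 1) - (hi i - lo i) := by
    rw [Int.toNat_of_nonneg (by linarith)]
    ring
  exact_mod_cast h3

/-! ### Every dimension -/

theorem width_congr {ξ b b' : Module.Basis (Fin d) ℝ (E d)} {I : Config d n} {i : Fin d}
    (h : ∀ x, b.repr x i = b'.repr x i) : width ξ b I i = width ξ b' I i := by
  simp only [width, maxCoord, minCoord, h]

theorem prod_eq_mul_mul_prod_erase {i j : Fin d} (hij : i ≠ j) (f : Fin d → ℝ) :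
    ∏ k, f k = f i * f j * ∏ k ∈ (Finset.univ.erase i).erase j, f k := by
  rw [mul_assoc, Finset.mul_prod_erase _ f (by simp [hij.symm]),
    Finset.mul_prod_erase _ f (Finset.mem_univ i)]

/-- The width products of three unimodular bases are linearly dependent. -/
theorem exists_bases_prod_width (ξ : Module.Basis (Fin d) ℝ (E d)) (n : ℕ) (hd : 1 < d) :
    ∃ b₁ b₂ b₃ : Module.Basis (Fin d) ℝ (E d),
      (lattice b₁ = lattice ξ ∧ ξ.det b₁ = 1) ∧ (lattice b₂ = lattice ξ ∧ ξ.det b₂ = 1) ∧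
      (lattice b₃ = lattice ξ ∧ ξ.det b₃ = 1) ∧
      ∀ I : Config d n, I.Nonempty →
        ∏ i, (-width ξ b₃ I i) - ∏ i, (-width ξ b₂ I i) = 2 * ∏ i, (-width ξ b₁ I i) := by
  let i₀ : Fin d := ⟨0, by omega⟩
  let i₁ : Fin d := ⟨1, hd⟩
  have h01 : i₀ ≠ i₁ := by simp [i₀, i₁]
  -- With `x, y` the coordinates `i₀, i₁` of `ξ`, all three bases have `x - (n + 1) y` in slot `i₀`.
  -- In slot `i₁` they have `y`, `x - n y` and `(n + 2) y - x`.
  set b₁ := shear ξ h01.symm (n + 1) with hb₁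
  set b₂ := shear b₁ h01 (-1) with hb₂
  set b₃ := shear b₁ h01 1 with hb₃
  have l₁ : lattice b₁ = lattice ξ := lattice_shear _ _ _
  have d₁ : ξ.det b₁ = 1 := (det_shear _ _ _ _).trans ξ.det_self
  refine ⟨b₁, b₂, b₃, ⟨l₁, d₁⟩, ⟨(lattice_shear _ _ _).trans l₁, (det_shear _ _ _ _).trans d₁⟩,
    ⟨(lattice_shear _ _ _).trans l₁, (det_shear _ _ _ _).trans d₁⟩, fun I hI => ?_⟩
  have r10 : ∀ x, b₁.repr x i₀ = ξ.repr x i₀ - (n + 1) * ξ.repr x i₁ := by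
    intro x
    rw [hb₁, shear_repr_self]
    push_cast
    rfl
  have r11 : ∀ x, b₁.repr x i₁ = ξ.repr x i₁ := fun x => shear_repr_of_ne _ _ _ _ h01.symm
  have r20 : ∀ x, b₂.repr x i₀ = b₁.repr x i₀ := fun x => shear_repr_of_ne _ _ _ _ h01
  have r30 : ∀ x, b₃.repr x i₀ = b₁.repr x i₀ := fun x => shear_repr_of_ne _ _ _ _ h01
  have r21 : ∀ x, b₂.repr x i₁ = b₁.repr x i₁ + b₁.repr x i₀ := by
    intro x
    rw [hb₂, shear_repr_self]
    push_cast
    ring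
  have r31 : ∀ x, b₃.repr x i₁ = b₁.repr x i₁ - b₁.repr x i₀ := by
    intro x
    rw [hb₃, shear_repr_self]
    push_cast
    ring
  obtain ⟨p, hp, hpm⟩ := I.exists_max_image
    (fun m => ((n : ℤ) + 1) * ((m i₁ : ℕ) : ℤ) - ((m i₀ : ℕ) : ℤ)) hI
  obtain ⟨q, hq, hqm⟩ := I.exists_min_image
    (fun m => ((n : ℤ) + 1) * ((m i₁ : ℕ) : ℤ) - ((m i₀ : ℕ) : ℤ)) hI
  -- As `0 ≤ x < n`, the form `(n + 1) y - x` orders pixels by `y` first and by `-x` second. The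
  -- forms `y` and `n y - x` are monotone for this order, so the same `p` and `q` are extremal for
  -- all forms in slots `i₀` and `i₁`, up to sign.
  have mono : ∀ m m' : Fin d → Fin n,
      ((n : ℤ) + 1) * ((m i₁ : ℕ) : ℤ) - ((m i₀ : ℕ) : ℤ) ≤
        ((n : ℤ) + 1) * ((m' i₁ : ℕ) : ℤ) - ((m' i₀ : ℕ) : ℤ) →
      ((m i₁ : ℕ) : ℤ) ≤ ((m' i₁ : ℕ) : ℤ) ∧
      (n : ℤ) * ((m i₁ : ℕ) : ℤ) - ((m i₀ : ℕ) : ℤ) ≤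
        (n : ℤ) * ((m' i₁ : ℕ) : ℤ) - ((m' i₀ : ℕ) : ℤ) := by
    intro m m' h
    have h1 : ((m i₀ : ℕ) : ℤ) < n := by exact_mod_cast (m i₀).2
    have h2 : ((m' i₀ : ℕ) : ℤ) < n := by exact_mod_cast (m' i₀).2
    have h3 : (0 : ℤ) ≤ ((m i₀ : ℕ) : ℤ) := by positivity
    have h4 : (0 : ℤ) ≤ ((m' i₀ : ℕ) : ℤ) := by positivity
    have h5 : ((m i₁ : ℕ) : ℤ) ≤ ((m' i₁ : ℕ) : ℤ) := by
      by_contra hlt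
      nlinarith
    refine ⟨h5, ?_⟩
    rcases h5.eq_or_lt with h6 | h6
    · rw [h6] at h ⊢
      linarith
    · nlinarith
  have toReal : ∀ m m' : Fin d → Fin n,
      ((n : ℤ) + 1) * ((m i₁ : ℕ) : ℤ) - ((m i₀ : ℕ) : ℤ) ≤
        ((n : ℤ) + 1) * ((m' i₁ : ℕ) : ℤ) - ((m' i₀ : ℕ) : ℤ) →
      ξ.repr (cellPoint ξ m) i₁ ≤ ξ.repr (cellPoint ξ m') i₁ ∧
      n * ξ.repr (cellPoint ξ m) i₁ - ξ.repr (cellPoint ξ m) i₀ ≤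
        n * ξ.repr (cellPoint ξ m') i₁ - ξ.repr (cellPoint ξ m') i₀ := by
    intro m m' h
    simp only [repr_cellPoint]
    exact_mod_cast mono m m' h
  have hP := fun m hm => toReal m p (hpm m hm)
  have hQ := fun m hm => toReal q m (hqm m hm)
  have w10 : width ξ b₁ I i₀ = b₁.repr (cellPoint ξ q) i₀ - b₁.repr (cellPoint ξ p) i₀ := by
    refine width_eq hq hp (fun m hm => ?_) fun m hm => ?_
    · rw [r10, r10]; linarith [hQ m hm]
    · rw [r10, r10]; linarith [hP m hm]
  have w20 : width ξ b₂ I i₀ = width ξ b₁ I i₀ := width_congr r20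
  have w30 : width ξ b₃ I i₀ = width ξ b₁ I i₀ := width_congr r30
  have w11 : width ξ b₁ I i₁ = b₁.repr (cellPoint ξ p) i₁ - b₁.repr (cellPoint ξ q) i₁ := by
    refine width_eq hp hq (fun m hm => ?_) fun m hm => ?_
    · rw [r11, r11]; exact (hP m hm).1
    · rw [r11, r11]; exact (hQ m hm).1
  have w21 : width ξ b₂ I i₁ = b₂.repr (cellPoint ξ q) i₁ - b₂.repr (cellPoint ξ p) i₁ := by
    refine width_eq hq hp (fun m hm => ?_) fun m hm => ?_
    · simp only [r21, r10, r11]; linarith [hQ m hm]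
    · simp only [r21, r10, r11]; linarith [hP m hm]
  have w31 : width ξ b₃ I i₁ = b₃.repr (cellPoint ξ p) i₁ - b₃.repr (cellPoint ξ q) i₁ := by
    refine width_eq hp hq (fun m hm => ?_) fun m hm => ?_
    · simp only [r31, r10, r11]; linarith [hP m hm]
    · simp only [r31, r10, r11]; linarith [hQ m hm]
  have e2 : ∏ k ∈ (Finset.univ.erase i₀).erase i₁, (-width ξ b₂ I k) =
      ∏ k ∈ (Finset.univ.erase i₀).erase i₁, (-width ξ b₁ I k) :=
    Finset.prod_congr rfl fun k hk => by
      rw [width_congr fun x => shear_repr_of_ne _ _ _ x (Finset.ne_of_mem_erase hk)]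
  have e3 : ∏ k ∈ (Finset.univ.erase i₀).erase i₁, (-width ξ b₃ I k) =
      ∏ k ∈ (Finset.univ.erase i₀).erase i₁, (-width ξ b₁ I k) :=
    Finset.prod_congr rfl fun k hk => by
      rw [width_congr fun x => shear_repr_of_ne _ _ _ x (Finset.ne_of_mem_erase hk)]
  -- If `t, u` are the widths for `b₁` in slots `i₀, i₁`, then slot `i₁` has width `t - u` for `b₂`
  -- and `t + u` for `b₃`. The claim is `t (t + u) - t (t - u) = 2 t u`.
  rw [prod_eq_mul_mul_prod_erase h01, prod_eq_mul_mul_prod_erase h01,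
    prod_eq_mul_mul_prod_erase h01, e2, e3, w20, w30, w21, w31, w11, r21, r21, r31, r31, w10]
  ring

/-- The linear relation between the width products passes to the limit and gives `0 = 2`. The filter
is arbitrary so that both the means and the untranslated counts are covered. -/
theorem not_tendsto_sum_prod_width (ξ : Module.Basis (Fin d) ℝ (E d)) (hd : 1 < d) {α : Type*}
    {F : Filter α} [F.NeBot] (W : α → Config d n → ℝ)
    (h : ∀ b : Module.Basis (Fin d) ℝ (E d), lattice b = lattice ξ → ξ.det b = 1 →
      Tendsto (fun a => ∑ I : Config d n with I.Nonempty, W a I * ∏ i, (-width ξ b I i)) F (𝓝 1)) :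
    False := by
  obtain ⟨b₁, b₂, b₃, h₁, h₂, h₃, hw⟩ := exists_bases_prod_width ξ n hd
  have t := (h b₃ h₃.1 h₃.2).sub (h b₂ h₂.1 h₂.2)
  have t' := (h b₁ h₁.1 h₁.2).const_mul 2
  have e : (fun a => ∑ I : Config d n with I.Nonempty, W a I * ∏ i, (-width ξ b₃ I i) -
      ∑ I : Config d n with I.Nonempty, W a I * ∏ i, (-width ξ b₂ I i)) =
      fun a => 2 * ∑ I : Config d n with I.Nonempty, W a I * ∏ i, (-width ξ b₁ I i) := by
    funext a
    rw [← Finset.sum_sub_distrib, Finset.mul_sum]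
    refine Finset.sum_congr rfl fun I hI => ?_
    rw [← mul_sub, hw I (by simpa using hI)]
    ring
  rw [e] at t
  have := tendsto_nhds_unique t t'
  norm_num at this

theorem not_isAsymptoticallyUnbiasedOn (ξ : Module.Basis (Fin d) ℝ (E d)) (hd : 1 < d)
    (w : ℝ → Config d n → ℝ) :
    ¬ IsAsymptoticallyUnbiasedOn ξ (localAlgorithm ξ w) eulerChar (polytopes d) := by
  intro hu
  obtain ⟨W, hW⟩ := exists_estimate_eq_sum_hitCount ξ w
  refine not_tendsto_sum_prod_width ξ hd (F := 𝓝[>] (0 : ℝ)) W fun b _ hb => ?_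
  have hs : ∀ (x : Fin d → Fin 2) (i : Fin d), (0 : ℝ) < ((x i : ℕ) : ℝ) + 1 := by
    intro x i; positivity
  have h1 : ∀ x : Fin d → Fin 2, Tendsto (fun a => ∑ I : Config d n with I.Nonempty,
      W a I * ∏ i, ((((x i : ℕ) : ℝ) + 1) * a⁻¹ - width ξ b I i)) (𝓝[>] 0) (𝓝 1) := by
    intro x
    have h2 := hu (box b 0 fun i => ((x i : ℕ) : ℝ) + 1) (box_mem_polytopes b (hs x))
    rw [IsAsymptoticallyUnbiasedAt, eulerChar_box b (l := 0) fun i => (hs x i).le] at h2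
    refine h2.congr' ?_
    filter_upwards [meanEstimate_box ξ w W hW b (hs x)] with a ha
    rw [ha, hb, abs_one, one_mul]
  have h3 := tendsto_sum_extractCoeff h1
  simpa only [sum_extractCoeff_mul_sum] using h3

theorem not_isMultigridConvergentOn (ξ : Module.Basis (Fin d) ℝ (E d)) (hd : 1 < d)
    (w : ℝ → Config d n → ℝ) :
    ¬ IsMultigridConvergentOn ξ (localAlgorithm ξ w) eulerChar (polytopes d) := by
  intro hu
  obtain ⟨W, hW⟩ := exists_estimate_eq_sum_hitCount ξ w
  -- Multigrid convergence is tested only along `a = 1 / (2 j + 1)`, where the count in a box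
  -- shifted by `1/2` is exact.
  refine not_tendsto_sum_prod_width ξ hd (F := atTop (α := ℕ))
    (fun j => W (2 * j + 1 : ℝ)⁻¹) fun b hl _ => ?_
  have htop : Tendsto (fun j : ℕ => (2 * j + 1 : ℝ)) atTop atTop :=
    tendsto_atTop_add_const_right _ _ (tendsto_natCast_atTop_atTop.const_mul_atTop two_pos)
  have hzero : Tendsto (fun j : ℕ => (2 * j + 1 : ℝ)⁻¹) atTop (𝓝[>] 0) :=
    tendsto_inv_atTop_nhdsGT_zero.comp htop
  have h1 : ∀ x : Fin d → Fin 2, Tendsto (fun j : ℕ => ∑ I : Config d n with I.Nonempty,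
      W (2 * j + 1 : ℝ)⁻¹ I *
        ∏ i, ((((x i : ℕ) : ℝ) + 1) * (2 * j + 1 : ℝ) - width ξ b I i)) atTop (𝓝 1) := by
    intro x
    let s : Fin d → ℕ := fun i => x i + 1
    have hs : ∀ i, (1 / 2 : ℝ) < s i + 1 / 2 := by
      intro i
      have : (0 : ℝ) < s i := by positivity
      linarith
    have h2 := (hu (box b (fun _ => 1 / 2) fun i => s i + 1 / 2) (box_mem_polytopes b hs)).comp
      hzero
    rw [eulerChar_box b fun i => (hs i).le] at h2
    have hev : ∀ᶠ j : ℕ in atTop, ∀ (I : Config d n) i, width ξ b I i ≤ s i * (2 * j + 1) := by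
      rw [eventually_all]; intro I
      rw [eventually_all]; intro i
      exact (htop.const_mul_atTop (by positivity)).eventually_ge_atTop _
    refine h2.congr' ?_
    filter_upwards [hev] with j hj
    rw [Function.comp_apply, hW _ (isCompact_box b _ _).isBounded _ (by positivity)]
    refine Finset.sum_congr rfl fun I hI => ?_
    rw [hitCount_box hl (by simpa using hI) s j (hj I)]
    simp only [s]
    push_cast
    rfl
  have h3 := tendsto_sum_extractCoeff h1
  simpa only [sum_extractCoeff_mul_sum] using h3

/-! ### Linear independence of the trigonometric functions -/

/-- The unit vectors at angles `θ` and `θ + δ` have determinant `sin δ`, so a linear form vanishing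
at both is zero. -/
theorem eq_zero_of_two_zeros {A B θ δ : ℝ} (hδ : Real.sin δ ≠ 0)
    (h₀ : A * Real.cos θ + B * Real.sin θ = 0)
    (h₁ : A * Real.cos (θ + δ) + B * Real.sin (θ + δ) = 0) : A = 0 ∧ B = 0 := by
  rw [Real.cos_add, Real.sin_add] at h₁
  have hs := Real.sin_sq_add_cos_sq θ
  have h₂ : (-A * Real.sin θ + B * Real.cos θ) * Real.sin δ = 0 := by
    linear_combination h₁ - Real.cos δ * h₀
  have h₃ := (mul_eq_zero.1 h₂).resolve_right hδ
  constructor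
  · linear_combination (-A) * hs + Real.cos θ * h₀ - Real.sin θ * h₃
  · linear_combination (-B) * hs + Real.sin θ * h₀ + Real.cos θ * h₃

/-- After multiplication by `sin ψ` and the substitution `θ = φ + ψ`, a relation is a bilinear form
in the unit vectors at `φ` and `θ`, with matrix entries `g 1`, `g 3 + g 0`, `g 3 - g 0`, `g 2`.
Vanishing on a 2 × 2 grid of angles forces it to be zero. -/
theorem linearIndependent_trig (U : Set (ℝ × ℝ)) (hU : IsOpen U) (hne : U.Nonempty)
    (hψ : ∀ p ∈ U, 0 < p.2 ∧ p.2 < Real.pi) :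
    LinearIndependent ℝ
      (![fun _ => 1, fun p => trig₁ p.1.1 p.1.2, fun p => trig₂ p.1.1 p.1.2,
        fun p => trig₃ p.1.1 p.1.2] : Fin 4 → U → ℝ) := by
  rw [Fintype.linearIndependent_iff]
  intro g hg
  obtain ⟨⟨φ, ψ⟩, hp⟩ := hne
  obtain ⟨ε, hε, hball⟩ := Metric.isOpen_iff.1 hU _ hp
  have key : ∀ φ' θ' : ℝ, (φ', θ' - φ') ∈ U →
      (g 1 * Real.cos θ' + (g 3 + g 0) * Real.sin θ') * Real.cos φ' +
        ((g 3 - g 0) * Real.cos θ' + g 2 * Real.sin θ') * Real.sin φ' = 0 := by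
    intro φ' θ' h
    have h1 := congrFun hg ⟨_, h⟩
    have hs : Real.sin (θ' - φ') ≠ 0 :=
      (Real.sin_pos_of_pos_of_lt_pi (hψ _ h).1 (hψ _ h).2).ne'
    simp only [Fin.sum_univ_four, Pi.add_apply, Pi.smul_apply, smul_eq_mul, Pi.zero_apply,
      Matrix.cons_val_zero, Matrix.cons_val_one, Matrix.cons_val, trig₁, trig₂, trig₃,
      add_sub_cancel] at h1
    field_simp at h1
    rw [Real.sin_sub] at h1
    linear_combination h1
  set δ : ℝ := min (ε / 2) 1 with hδ
  have hδ0 : 0 < δ := lt_min (by linarith) one_pos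
  have hδε : δ < ε := (min_le_left _ _).trans_lt (by linarith)
  have hsin : Real.sin δ ≠ 0 := (Real.sin_pos_of_pos_of_lt_pi hδ0
    ((min_le_right _ _).trans_lt (by linarith [Real.pi_gt_three]))).ne'
  have hmem : ∀ x y : ℝ, |x| < ε → |y - x| < ε → (φ + x, (φ + ψ + y) - (φ + x)) ∈ U := by
    intro x y hx hy
    apply hball
    rw [Metric.mem_ball, Prod.dist_eq, max_lt_iff]
    simp only [Real.dist_eq]
    constructor
    · simpa using hx
    · rwa [show φ + ψ + y - (φ + x) - ψ = y - x by ring]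
  have h00 := key _ _ (hmem 0 0 (by simpa using hε) (by simpa using hε))
  have h01 := key _ _ (hmem 0 δ (by simpa using hε) (by simpa [abs_of_pos hδ0] using hδε))
  have h10 := key _ _ (hmem δ 0 (by simpa [abs_of_pos hδ0] using hδε)
    (by simpa [abs_of_pos hδ0] using hδε))
  have h11 := key _ _ (hmem δ δ (by simpa [abs_of_pos hδ0] using hδε) (by simpa using hε))
  simp only [add_zero] at h00 h01 h10
  obtain ⟨a0, b0⟩ := eq_zero_of_two_zeros hsin h00 h10
  obtain ⟨a1, b1⟩ := eq_zero_of_two_zeros hsin h01 h11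
  obtain ⟨e1, e2⟩ := eq_zero_of_two_zeros hsin a0 a1
  obtain ⟨e3, e4⟩ := eq_zero_of_two_zeros hsin b0 b1
  intro i
  fin_cases i
  · change g 0 = 0
    linarith
  · exact e1
  · exact e4
  · change g 3 = 0
    linarith

/-- A pointwise limit of combinations of three functions is such a combination. -/
theorem exists_combination_of_tendsto {T α : Type*} {F : Filter α} [F.NeBot]
    {f₁ f₂ f₃ L : T → ℝ} {α₁ α₂ α₃ : α → ℝ}
    (h : ∀ p, Tendsto (fun a => α₁ a * f₁ p + α₂ a * f₂ p + α₃ a * f₃ p) F (𝓝 (L p))) :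
    ∃ β₁ β₂ β₃ : ℝ, ∀ p, L p = β₁ * f₁ p + β₂ * f₂ p + β₃ * f₃ p := by
  set S : Submodule ℝ (T → ℝ) := Submodule.span ℝ {f₁, f₂, f₃} with hS
  have : FiniteDimensional ℝ S := FiniteDimensional.span_of_finite ℝ (Set.toFinite _)
  -- The coefficients themselves may diverge; closedness of a finite-dimensional subspace under
  -- pointwise limits is what suffices.
  have hcl : IsClosed (S : Set (T → ℝ)) := S.closed_of_finiteDimensional
  have hL : L ∈ S := by
    refine hcl.mem_of_tendsto (tendsto_pi_nhds.2 h) (Eventually.of_forall fun a => ?_)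
    rw [SetLike.mem_coe, hS, Submodule.mem_span_triple]
    exact ⟨α₁ a, α₂ a, α₃ a, rfl⟩
  rw [hS, Submodule.mem_span_triple] at hL
  obtain ⟨β₁, β₂, β₃, rfl⟩ := hL
  exact ⟨β₁, β₂, β₃, fun p => rfl⟩

/-! ### Parallelograms -/

/-- The determinant of two vectors of the plane. -/
def det₂ (u x : E 2) : ℝ := u 0 * x 1 - u 1 * x 0

theorem dir_zero (φ : ℝ) : dir φ 0 = Real.cos φ := rfl

theorem dir_one (φ : ℝ) : dir φ 1 = Real.sin φ := rfl

theorem sin_eq_dir (φ ψ : ℝ) :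
    Real.sin ψ = Real.cos φ * Real.sin (φ + ψ) - Real.sin φ * Real.cos (φ + ψ) := by
  have := Real.sin_sub (φ + ψ) φ
  rw [add_sub_cancel_left] at this
  rw [this]
  ring

/-- The basis of the plane that consists of the directions of the angles `φ` and `φ + ψ`. -/
def dirBasis (φ : ℝ) {ψ : ℝ} (hψ : Real.sin ψ ≠ 0) : Module.Basis (Fin 2) ℝ (E 2) :=
  Module.Basis.ofEquivFun
    { toFun := fun x => ![-det₂ (dir (φ + ψ)) x / Real.sin ψ, det₂ (dir φ) x / Real.sin ψ]
      invFun := fun t => t 0 • dir φ + t 1 • dir (φ + ψ)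
      map_add' := fun x y => by
        ext i; fin_cases i <;> simp [det₂] <;> ring
      map_smul' := fun c x => by
        ext i; fin_cases i <;> simp [det₂] <;> ring
      left_inv := fun x => by
        have h := sin_eq_dir φ ψ
        ext i
        fin_cases i
        · simp only [Matrix.cons_val_zero, Matrix.cons_val_one, PiLp.add_apply, PiLp.smul_apply,
            smul_eq_mul, det₂, dir_zero, dir_one, Fin.zero_eta]
          field_simp
          rw [h]; ring
        · simp only [Matrix.cons_val_zero, Matrix.cons_val_one, PiLp.add_apply, PiLp.smul_apply,
            smul_eq_mul, det₂, dir_zero, dir_one, Fin.mk_one]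
          field_simp
          rw [h]; ring
      right_inv := fun t => by
        have h := sin_eq_dir φ ψ
        ext i
        fin_cases i
        · simp only [Matrix.cons_val_zero, PiLp.add_apply, PiLp.smul_apply,
            smul_eq_mul, det₂, dir_zero, dir_one, Fin.zero_eta]
          field_simp
          rw [h]; ring
        · simp only [Matrix.cons_val_zero, Matrix.cons_val_one, PiLp.add_apply, PiLp.smul_apply,
            smul_eq_mul, det₂, dir_zero, dir_one, Fin.mk_one]
          field_simp
          rw [h]; ring }

theorem dirBasis_repr_zero (φ : ℝ) {ψ : ℝ} (hψ : Real.sin ψ ≠ 0) (x : E 2) :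
    (dirBasis φ hψ).repr x 0 = -det₂ (dir (φ + ψ)) x / Real.sin ψ := rfl

theorem dirBasis_repr_one (φ : ℝ) {ψ : ℝ} (hψ : Real.sin ψ ≠ 0) (x : E 2) :
    (dirBasis φ hψ).repr x 1 = det₂ (dir φ) x / Real.sin ψ := rfl

theorem dirBasis_zero (φ : ℝ) {ψ : ℝ} (hψ : Real.sin ψ ≠ 0) : dirBasis φ hψ 0 = dir φ := by
  rw [dirBasis, Module.Basis.coe_ofEquivFun]
  simp

theorem dirBasis_one (φ : ℝ) {ψ : ℝ} (hψ : Real.sin ψ ≠ 0) :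
    dirBasis φ hψ 1 = dir (φ + ψ) := by
  rw [dirBasis, Module.Basis.coe_ofEquivFun]
  simp

theorem parallelogram_eq_box (φ : ℝ) {ψ : ℝ} (hψ : Real.sin ψ ≠ 0) {s : Fin 2 → ℝ}
    (hs : ∀ i, 0 ≤ s i) : parallelogram φ ψ (s 0) (s 1) = box (dirBasis φ hψ) 0 s := by
  rw [box_zero_eq_parallelepiped _ hs, parallelepiped_eq_sum_segment, Fin.sum_univ_two,
    dirBasis_zero, dirBasis_one, parallelogram]

theorem det_dirBasis (ξ : Module.Basis (Fin 2) ℝ (E 2)) (φ : ℝ) {ψ : ℝ} (hψ : Real.sin ψ ≠ 0) :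
    ξ.det (dirBasis φ hψ) =
      ξ.det (EuclideanSpace.basisFun (Fin 2) ℝ).toBasis * Real.sin ψ := by
  set e := (EuclideanSpace.basisFun (Fin 2) ℝ).toBasis
  have h := ξ.det.eq_smul_basis_det e
  conv_lhs => rw [h]
  rw [AlternatingMap.smul_apply, smul_eq_mul, e.det_apply, Matrix.det_fin_two,
    sin_eq_dir φ ψ]
  simp only [Module.Basis.toMatrix_apply, dirBasis_zero, dirBasis_one]
  congr 1
  simp only [e, OrthonormalBasis.coe_toBasis_repr_apply, EuclideanSpace.basisFun_repr, dir_zero,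
    dir_one]
  ring

/-! ### Connected components of directions -/

theorem eq_smul_of_det₂_eq_zero {u z : E 2} (hu : ‖u‖ = 1) (hz : z ≠ 0) (h : det₂ u z = 0) :
    u = ‖z‖⁻¹ • z ∨ u = ‖-z‖⁻¹ • (-z) := by
  have hz2 : z 0 ^ 2 + z 1 ^ 2 ≠ 0 := by
    intro h0
    apply hz
    ext i
    fin_cases i
    · change z 0 = 0
      exact pow_eq_zero_iff two_ne_zero |>.1 (by linarith [sq_nonneg (z 0), sq_nonneg (z 1)])
    · change z 1 = 0
      exact pow_eq_zero_iff two_ne_zero |>.1 (by linarith [sq_nonneg (z 0), sq_nonneg (z 1)])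
  set c := (u 0 * z 0 + u 1 * z 1) / (z 0 ^ 2 + z 1 ^ 2) with hc
  have huc : u = c • z := by
    unfold det₂ at h
    ext i
    fin_cases i
    · change u 0 = c * z 0
      rw [hc]
      field_simp
      linear_combination z 1 * h
    · change u 1 = c * z 1
      rw [hc]
      field_simp
      linear_combination (-z 0) * h
  have hz' : ‖z‖ ≠ 0 := norm_ne_zero_iff.2 hz
  have hcn : |c| = ‖z‖⁻¹ := by
    rw [huc, norm_smul, Real.norm_eq_abs] at hu
    exact eq_inv_of_mul_eq_one_left hu
  rcases abs_choice c with h1 | h1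
  · left; rw [huc, ← hcn, h1]
  · right; rw [huc, norm_neg, ← hcn, h1, smul_neg, neg_smul, neg_neg]

theorem det₂_ne_zero_of_notMem_latticeDirections {ξ : Module.Basis (Fin 2) ℝ (E 2)} {u : E 2}
    (hu : u ∈ Metric.sphere (0 : E 2) 1 \ latticeDirections ξ n)
    {m : Fin 2 → ℤ} (hm : ∀ i, -(n : ℤ) < m i ∧ m i < n)
    (hz : ∑ i, (m i : ℝ) • ξ i ≠ 0) : det₂ u (∑ i, (m i : ℝ) • ξ i) ≠ 0 := by
  intro h0
  have hm0 : m ≠ 0 := by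
    rintro rfl
    exact hz (by simp)
  have hun : ‖u‖ = 1 := by simpa using hu.1
  -- The index range of `latticeDirections` is not symmetric, but coordinates strictly between `-n`
  -- and `n` stay in it under negation.
  rcases eq_smul_of_det₂_eq_zero hun hz h0 with h1 | h1
  · exact hu.2 ⟨m, fun i => ⟨(hm i).1.le, (hm i).2⟩, hm0, h1⟩
  · refine hu.2 ⟨-m, fun i => ?_, neg_ne_zero.2 hm0, ?_⟩
    · have := hm i
      simp only [Pi.neg_apply]
      omega
    · have : ∑ i, (((-m) i : ℤ) : ℝ) • ξ i = -∑ i, (m i : ℝ) • ξ i := by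
        rw [← Finset.sum_neg_distrib]
        simp
      rw [this]
      exact h1

theorem det₂_sub (u x y : E 2) : det₂ u (x - y) = det₂ u x - det₂ u y := by
  simp only [det₂, PiLp.sub_apply]
  ring

/-- All directions of a component order the pixels in the same way. -/
theorem det₂_cellPoint_le {ξ : Module.Basis (Fin 2) ℝ (E 2)} {v v' : E 2}
    (hv : v ∈ Metric.sphere (0 : E 2) 1 \ latticeDirections ξ n) (hv' : v' ∈ dirComponent ξ n v)
    {p q : Fin 2 → Fin n} (h : det₂ v (cellPoint ξ p) ≤ det₂ v (cellPoint ξ q)) :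
    det₂ v' (cellPoint ξ p) ≤ det₂ v' (cellPoint ξ q) := by
  let m : Fin 2 → ℤ := fun i => ((q i : ℕ) : ℤ) - ((p i : ℕ) : ℤ)
  have hz : cellPoint ξ q - cellPoint ξ p = ∑ i, (m i : ℝ) • ξ i := by
    simp only [cellPoint, ← Finset.sum_sub_distrib, ← sub_smul, m]
    push_cast
    rfl
  have hm : ∀ i, -(n : ℤ) < m i ∧ m i < n := by
    intro i
    have h1 := (p i).2
    have h2 := (q i).2
    simp only [m]
    omega
  rw [← sub_nonneg, ← det₂_sub, hz] at h ⊢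
  by_contra! hneg
  have hz0 : ∑ i, (m i : ℝ) • ξ i ≠ 0 := by
    intro h0
    rw [h0] at hneg
    simp [det₂] at hneg
  have hcont : Continuous fun u : E 2 => det₂ u (∑ i, (m i : ℝ) • ξ i) := by
    unfold det₂
    fun_prop
  -- A change of sign inside the connected component would produce a zero of the determinant, that
  -- is, a direction in `D_Λ`.
  have hpc : IsPreconnected (dirComponent ξ n v) := isPreconnected_connectedComponentIn
  obtain ⟨u, hu, hu0⟩ := hpc.intermediate_value hv' (mem_connectedComponentIn hv)
    hcont.continuousOn ⟨hneg.le, h⟩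
  exact det₂_ne_zero_of_notMem_latticeDirections (connectedComponentIn_subset _ _ hu) hm hz0 hu0

/-! ### Means at parallelograms -/

/-- One pair of extremal pixels per `I`, found at `v`, serves every direction of the component. The
product of the two widths is `det₂ v₁ Z * det₂ v₂ Z / sin ψ ^ 2`, and the Jacobian supplies a factor
`sin ψ`; expanding gives the three functions. -/
theorem exists_extractCoeff_mean_eq (ξ : Module.Basis (Fin 2) ℝ (E 2)) (w : ℝ → Config 2 n → ℝ)
    {v : E 2} (hv : v ∈ Metric.sphere (0 : E 2) 1 \ latticeDirections ξ n) :
    ∃ α₁ α₂ α₃ : ℝ → ℝ, ∀ φ ψ : ℝ, 0 < ψ → ψ < Real.pi →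
      dir φ ∈ dirComponent ξ n v → dir (φ + ψ) ∈ dirComponent ξ n v →
      ∀ᶠ a in 𝓝[>] (0 : ℝ), ∑ x : Fin 2 → Fin 2, extractCoeff x *
        meanEstimate ξ (localAlgorithm ξ w)
          (parallelogram φ ψ (((x 0 : ℕ) : ℝ) + 1) (((x 1 : ℕ) : ℝ) + 1)) a =
        α₁ a * trig₁ φ ψ + α₂ a * trig₂ φ ψ + α₃ a * trig₃ φ ψ := by
  obtain ⟨W, hW⟩ := exists_estimate_eq_sum_hitCount ξ w
  have hex : ∀ I : Config 2 n, ∃ Z : E 2, I.Nonempty → ∃ p ∈ I, ∃ q ∈ I,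
      Z = cellPoint ξ p - cellPoint ξ q ∧
      ∀ m ∈ I, det₂ v (cellPoint ξ m) ≤ det₂ v (cellPoint ξ p) ∧
        det₂ v (cellPoint ξ q) ≤ det₂ v (cellPoint ξ m) := by
    intro I
    by_cases hI : I.Nonempty
    · obtain ⟨p, hp, hpm⟩ := I.exists_max_image (fun m => det₂ v (cellPoint ξ m)) hI
      obtain ⟨q, hq, hqm⟩ := I.exists_min_image (fun m => det₂ v (cellPoint ξ m)) hI
      exact ⟨_, fun _ => ⟨p, hp, q, hq, rfl, fun m hm => ⟨hpm m hm, hqm m hm⟩⟩⟩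
    · exact ⟨0, fun h => absurd h hI⟩
  choose Z hZ using hex
  set κ : ℝ := |ξ.det (EuclideanSpace.basisFun (Fin 2) ℝ).toBasis| with hκ
  refine ⟨fun a => κ * ∑ I : Config 2 n with I.Nonempty, W a I * (Z I 1) ^ 2,
    fun a => κ * ∑ I : Config 2 n with I.Nonempty, W a I * (Z I 0) ^ 2,
    fun a => κ * ∑ I : Config 2 n with I.Nonempty, W a I * (-(Z I 0 * Z I 1)),
    fun φ ψ h0 hpi h1 h2 => ?_⟩
  have hsin := Real.sin_pos_of_pos_of_lt_pi h0 hpi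
  set b := dirBasis φ hsin.ne' with hb
  have hs : ∀ (x : Fin 2 → Fin 2) (i : Fin 2), (0 : ℝ) < ((x i : ℕ) : ℝ) + 1 := by
    intro x i; positivity
  have hev : ∀ᶠ a in 𝓝[>] (0 : ℝ), ∀ x : Fin 2 → Fin 2,
      meanEstimate ξ (localAlgorithm ξ w) (box b 0 fun i => ((x i : ℕ) : ℝ) + 1) a =
        |ξ.det b| * ∑ I : Config 2 n with I.Nonempty,
          W a I * ∏ i, ((((x i : ℕ) : ℝ) + 1) * a⁻¹ - width ξ b I i) := by
    rw [eventually_all]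
    exact fun x => meanEstimate_box ξ w W hW b (hs x)
  filter_upwards [hev] with a ha
  have hbox : ∀ x : Fin 2 → Fin 2,
      parallelogram φ ψ (((x 0 : ℕ) : ℝ) + 1) (((x 1 : ℕ) : ℝ) + 1) =
        box b 0 fun i => ((x i : ℕ) : ℝ) + 1 := fun x =>
    parallelogram_eq_box φ hsin.ne' (s := fun i => ((x i : ℕ) : ℝ) + 1) fun i => (hs x i).le
  simp only [hbox, ha, mul_left_comm (extractCoeff _)]
  rw [← Finset.mul_sum, sum_extractCoeff_mul_sum, hb, det_dirBasis, abs_mul, abs_of_pos hsin, ← hκ]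
  simp only [Finset.mul_sum, Finset.sum_mul]
  rw [← Finset.sum_add_distrib, ← Finset.sum_add_distrib]
  refine Finset.sum_congr rfl fun I hI => ?_
  obtain ⟨p, hp, q, hq, hZI, hmax⟩ := hZ I (by simpa using hI)
  have w1 : width ξ (dirBasis φ hsin.ne') I 1 = det₂ (dir φ) (Z I) / Real.sin ψ := by
    rw [width_eq hp hq, dirBasis_repr_one, dirBasis_repr_one, ← sub_div, hZI, det₂_sub]
    · intro m hm
      rw [dirBasis_repr_one, dirBasis_repr_one]
      exact div_le_div_of_nonneg_right (det₂_cellPoint_le hv h1 (hmax m hm).1) hsin.le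
    · intro m hm
      rw [dirBasis_repr_one, dirBasis_repr_one]
      exact div_le_div_of_nonneg_right (det₂_cellPoint_le hv h1 (hmax m hm).2) hsin.le
  have w0 : width ξ (dirBasis φ hsin.ne') I 0 = det₂ (dir (φ + ψ)) (Z I) / Real.sin ψ := by
    rw [width_eq hq hp, dirBasis_repr_zero, dirBasis_repr_zero, ← sub_div, hZI, det₂_sub]
    · congr 1; ring
    · intro m hm
      rw [dirBasis_repr_zero, dirBasis_repr_zero]
      exact div_le_div_of_nonneg_right (neg_le_neg (det₂_cellPoint_le hv h2 (hmax m hm).2)) hsin.le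
    · intro m hm
      rw [dirBasis_repr_zero, dirBasis_repr_zero]
      exact div_le_div_of_nonneg_right (neg_le_neg (det₂_cellPoint_le hv h2 (hmax m hm).1)) hsin.le
  rw [Fin.prod_univ_two, w0, w1]
  simp only [det₂, dir_zero, dir_one, trig₁, trig₂, trig₃]
  have := hsin.ne'
  field_simp
  ring

theorem exists_limit_eq_combination (ξ : Module.Basis (Fin 2) ℝ (E 2)) (w : ℝ → Config 2 n → ℝ)
    (v : E 2) (L : ℝ → ℝ → ℝ) (T : Set (ℝ × ℝ))
    (hT : ∀ p ∈ T, 0 < p.2 ∧ p.2 < Real.pi ∧ dir p.1 ∈ dirComponent ξ n v ∧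
      dir (p.1 + p.2) ∈ dirComponent ξ n v)
    (hL : ∀ p ∈ T, ∀ s₁ s₂ : ℝ, 0 < s₁ → 0 < s₂ →
      Tendsto (fun a => meanEstimate ξ (localAlgorithm ξ w) (parallelogram p.1 p.2 s₁ s₂) a)
        (𝓝[>] 0) (𝓝 (L p.1 p.2))) :
    ∃ α₁ α₂ α₃ : ℝ, ∀ p ∈ T,
      L p.1 p.2 = α₁ * trig₁ p.1 p.2 + α₂ * trig₂ p.1 p.2 + α₃ * trig₃ p.1 p.2 := by
  by_cases hv : v ∈ Metric.sphere (0 : E 2) 1 \ latticeDirections ξ n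
  · obtain ⟨α₁, α₂, α₃, h⟩ := exists_extractCoeff_mean_eq ξ w hv
    obtain ⟨β₁, β₂, β₃, hβ⟩ := exists_combination_of_tendsto (T := T) (F := 𝓝[>] (0 : ℝ))
      (f₁ := fun p => trig₁ p.1.1 p.1.2) (f₂ := fun p => trig₂ p.1.1 p.1.2)
      (f₃ := fun p => trig₃ p.1.1 p.1.2) (L := fun p => L p.1.1 p.1.2)
      (α₁ := α₁) (α₂ := α₂) (α₃ := α₃) fun p => by
        obtain ⟨h1, h2, h3, h4⟩ := hT p.1 p.2
        refine Tendsto.congr' (h p.1.1 p.1.2 h1 h2 h3 h4) ?_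
        exact tendsto_sum_extractCoeff fun x => hL p.1 p.2 _ _ (by positivity) (by positivity)
    exact ⟨β₁, β₂, β₃, fun p hp => hβ ⟨p, hp⟩⟩
  · refine ⟨0, 0, 0, fun p hp => ?_⟩
    have := (hT p hp).2.2.1
    rw [dirComponent, connectedComponentIn_eq_empty hv] at this
    exact absurd this (Set.notMem_empty _)

theorem continuous_dir : Continuous dir := by
  unfold dir
  fun_prop

theorem exists_parallelogram_biased (ξ : Module.Basis (Fin 2) ℝ (E 2)) (w : ℝ → Config 2 n → ℝ)
    (U : Set (ℝ × ℝ)) (hU : IsOpen U) (hne : U.Nonempty)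
    (h : ∀ p ∈ U, 0 < p.2 ∧ p.2 < Real.pi ∧ dir (p.1 + p.2) ∈ dirComponent ξ n (dir p.1)) :
    ∃ p ∈ U, ∃ s₁ s₂ : ℝ, 0 < s₁ ∧ 0 < s₂ ∧
      parallelogram p.1 p.2 s₁ s₂ ∈ polytopes 2 ∧
      ¬ IsAsymptoticallyUnbiasedAt ξ (localAlgorithm ξ w) eulerChar
        (parallelogram p.1 p.2 s₁ s₂) := by
  obtain ⟨p₀, hp₀⟩ := hne
  obtain ⟨ε, hε, hball⟩ := Metric.isOpen_iff.1 hU _ hp₀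
  by_contra hcon
  push Not at hcon
  have hF : ∀ p ∈ U, dir p.1 ∈ Metric.sphere (0 : E 2) 1 \ latticeDirections ξ n := by
    intro p hp
    by_contra hn
    have := (h p hp).2.2
    rw [dirComponent, connectedComponentIn_eq_empty hn] at this
    exact this
  -- Different points of `U` may belong to different components. On a ball, which is connected, the
  -- component is constant, so one triple of coefficients applies.
  have hsub : (fun p : ℝ × ℝ => dir p.1) '' Metric.ball p₀ ε ⊆ dirComponent ξ n (dir p₀.1) := by
    refine IsPreconnected.subset_connectedComponentIn ?_ ⟨p₀, Metric.mem_ball_self hε, rfl⟩ ?_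
    · exact (convex_ball p₀ ε).isPreconnected.image _
        (continuous_dir.comp continuous_fst).continuousOn
    · rintro _ ⟨p, hp, rfl⟩
      exact hF p (hball hp)
  have hT : ∀ p ∈ Metric.ball p₀ ε, 0 < p.2 ∧ p.2 < Real.pi ∧
      dir p.1 ∈ dirComponent ξ n (dir p₀.1) ∧ dir (p.1 + p.2) ∈ dirComponent ξ n (dir p₀.1) := by
    intro p hp
    obtain ⟨h1, h2, h3⟩ := h p (hball hp)
    have h4 := hsub ⟨p, hp, rfl⟩
    refine ⟨h1, h2, h4, ?_⟩
    rw [dirComponent, connectedComponentIn_eq h4]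
    exact h3
  obtain ⟨α₁, α₂, α₃, hα⟩ := exists_limit_eq_combination ξ w (dir p₀.1) (fun _ _ => 1)
    (Metric.ball p₀ ε) hT fun p hp s₁ s₂ hs₁ hs₂ => by
      have hsin := Real.sin_pos_of_pos_of_lt_pi (hT p hp).1 (hT p hp).2.1
      have hs : ∀ i, (0 : Fin 2 → ℝ) i < ![s₁, s₂] i := by
        intro i; fin_cases i <;> simpa
      have e : parallelogram p.1 p.2 s₁ s₂ = box (dirBasis p.1 hsin.ne') 0 ![s₁, s₂] :=
        parallelogram_eq_box p.1 hsin.ne' (s := ![s₁, s₂]) fun i => (hs i).le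
      have h1 := hcon p (hball hp) s₁ s₂ hs₁ hs₂ (by rw [e]; exact box_mem_polytopes _ hs)
      rwa [IsAsymptoticallyUnbiasedAt, show eulerChar (parallelogram p.1 p.2 s₁ s₂) = 1 by
        rw [e]; exact eulerChar_box _ fun i => (hs i).le] at h1
  have hli := linearIndependent_trig (Metric.ball p₀ ε) Metric.isOpen_ball
    ⟨p₀, Metric.mem_ball_self hε⟩ fun p hp => ⟨(hT p hp).1, (hT p hp).2.1⟩
  rw [Fintype.linearIndependent_iff] at hli
  have := hli ![-1, α₁, α₂, α₃] (by
    funext p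
    have := hα p.1 p.2
    simp only [Fin.sum_univ_four, Pi.add_apply, Pi.smul_apply, smul_eq_mul, Pi.zero_apply,
      Matrix.cons_val_zero, Matrix.cons_val_one, Matrix.cons_val]
    linarith) 0
  norm_num at this

end LocalEstimator

end

/-! ### Assembly of the theorem -/

open LocalEstimator in
theorem theorem2 :
    -- every dimension `d > 1`
    (∀ (d : ℕ), 1 < d → ∀ (ξ : Module.Basis (Fin d) ℝ (E d)) (n : ℕ), 1 ≤ n →
      ∀ w : ℝ → Config d n → ℝ, IsInvariant ξ w →
        IsIntegrableOn ξ (localAlgorithm ξ w) (polytopes d) ∧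
        ¬ IsAsymptoticallyUnbiasedOn ξ (localAlgorithm ξ w) eulerChar (polytopes d) ∧
        ¬ IsMultigridConvergentOn ξ (localAlgorithm ξ w) eulerChar (polytopes d)) ∧
    -- the plane: parallelograms with directions in one component of `S¹ ∖ D_Λ`
    (∀ (ξ : Module.Basis (Fin 2) ℝ (E 2)) (n : ℕ), 1 ≤ n →
      ∀ w : ℝ → Config 2 n → ℝ, IsInvariant ξ w →
        (∀ U : Set (ℝ × ℝ), IsOpen U → U.Nonempty →
          (∀ p ∈ U, 0 < p.2 ∧ p.2 < Real.pi ∧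
            dir (p.1 + p.2) ∈ dirComponent ξ n (dir p.1)) →
          ∃ p ∈ U, ∃ s₁ s₂ : ℝ, 0 < s₁ ∧ 0 < s₂ ∧
            parallelogram p.1 p.2 s₁ s₂ ∈ polytopes 2 ∧
            ¬ IsAsymptoticallyUnbiasedAt ξ (localAlgorithm ξ w) eulerChar
                (parallelogram p.1 p.2 s₁ s₂)) ∧
        (∀ (v : E 2) (L : ℝ → ℝ → ℝ),
          (∀ φ ψ : ℝ, 0 < ψ → ψ < Real.pi →
            dir φ ∈ dirComponent ξ n v → dir (φ + ψ) ∈ dirComponent ξ n v →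
            ∀ s₁ s₂ : ℝ, 0 < s₁ → 0 < s₂ →
              Tendsto
                (fun a => meanEstimate ξ (localAlgorithm ξ w) (parallelogram φ ψ s₁ s₂) a)
                (𝓝[>] 0) (𝓝 (L φ ψ))) →
          ∃ α₁ α₂ α₃ : ℝ, ∀ φ ψ : ℝ, 0 < ψ → ψ < Real.pi →
            dir φ ∈ dirComponent ξ n v → dir (φ + ψ) ∈ dirComponent ξ n v →
            L φ ψ = α₁ * trig₁ φ ψ + α₂ * trig₂ φ ψ + α₃ * trig₃ φ ψ)) ∧
    -- the trigonometric functions and the constant `1` are linearly independent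
    (∀ U : Set (ℝ × ℝ), IsOpen U → U.Nonempty → (∀ p ∈ U, 0 < p.2 ∧ p.2 < Real.pi) →
      LinearIndependent ℝ
        (![fun _ => 1, fun p => trig₁ p.1.1 p.1.2, fun p => trig₂ p.1.1 p.1.2,
          fun p => trig₃ p.1.1 p.1.2] : Fin 4 → U → ℝ)) := by
  refine ⟨fun d hd ξ n _ w _ => ⟨isIntegrableOn_polytopes ξ w,
    not_isAsymptoticallyUnbiasedOn ξ hd w, not_isMultigridConvergentOn ξ hd w⟩,
    fun ξ n _ w _ => ⟨fun U hU hne h => exists_parallelogram_biased ξ w U hU hne h,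
      fun v L hL => ?_⟩, linearIndependent_trig⟩
  obtain ⟨α₁, α₂, α₃, h⟩ := exists_limit_eq_combination ξ w v L
    {p | 0 < p.2 ∧ p.2 < Real.pi ∧ dir p.1 ∈ dirComponent ξ n v ∧
      dir (p.1 + p.2) ∈ dirComponent ξ n v} (fun p hp => hp)
    fun p hp => hL p.1 p.2 hp.1 hp.2.1 hp.2.2.1 hp.2.2.2
  exact ⟨α₁, α₂, α₃, fun φ ψ h1 h2 h3 h4 => h (φ, ψ) ⟨h1, h2, h3, h4⟩⟩
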